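/- Let $X\ge 1$ be an integer-valued random variable with $\mathbb P(X>x)=c\,x^{-\alpha}(1+o(1))$ as $x\to\infty$, for some $c,\alpha>0$. Let $\mathcal T$ be the branching process tree with root $\varnothing$ and offspring distribution $X$ (all vertices have independent offspring numbers distributed as $X$), and give its edges $e$ weights $w(e)$ that are i.i.d. uniform on $[0,1]$ and independent of $\mathcal T$. Invasion percolation starts from $T_0=\{\varnothing\}$ and obtains $T_n$ from $T_{n-1}$ by adding the edge of minimal weight among the edges joining a vertex of $T_{n-1}$ to a vertex outside it, together with its endpoint outside; the invasion percolation cluster is $T=\bigcup_n T_n$. Almost surely $T$ contains exactly one infinite path $v_0=\varnothing,v_1,v_2,\dots$ from the root (the backbone), and for every $k\ge0$ the component $\mathcal M_k$ of $\varnothing$ in $T$ after removal of the edge $\{v_k,v_{k+1}\}$ is finite. Let $\beta_i=w(\{v_{i-1},v_i\})$ for $i\ge1$, $W_k=\max_{i>k}\beta_i$, $C_k=\sum_{e\in E(\mathcal M_k)}w(e)$, $C_{-1}=0$ and $B_k=C_k-C_{k-1}$ for $k\ge 0$. Then, for almost every value $(w_k)_{k\ge0}$ of the sequence $(W_k)_{k\ge0}$,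 conditionally on $(W_k)_{k\ge0}=(w_k)_{k\ge0}$ the random variables $(B_i)_{i\ge0}$ are mutually independent. The same holds for the weights of the attached forests without the backbone edges, that is, for $B_0$ and $B_i-\beta_i$, $i\ge1$. -/

import Mathlib

open MeasureTheory ProbabilityTheory Filter Asymptotics

namespace IPC

/-! Deterministic part: a rooted weighted tree in Ulam–Harris coding. A vertex is a list of naturals,
the root is `[]`, and `i :: v` is the `i`-th child of `v` (so the ancestors of `v`, itself included,
are the suffixes of `v`). `X v` is the number of children of `v`, and `w v` is the weight of the edge
between `v ≠ []` and its parent (`w []` plays no role). -/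

/-- `v` is a vertex of the tree with offspring numbers `X`. -/
def InTree (X : List ℕ → ℕ) : List ℕ → Prop
  | [] => True
  | i :: v => InTree X v ∧ i < X v

/-- The vertices of the tree outside `S` that are joined by an edge to a vertex of `S`. -/
def boundary (X : List ℕ → ℕ) (S : Set (List ℕ)) : Set (List ℕ) :=
  {v | InTree X v ∧ v ∉ S ∧ ∃ u ∈ S, ∃ i : ℕ, v = i :: u}

/-- The boundary vertices whose edge to `S` has minimal weight. For pairwise distinct weights (an
almost sure event for i.i.d. uniform weights) there is at most one. -/
def argminBoundary (X : List ℕ → ℕ) (w : List ℕ → ℝ) (S : Set (List ℕ)) : Set (List ℕ) :=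
  {v | v ∈ boundary X S ∧ ∀ u ∈ boundary X S, w v ≤ w u}

/-- The vertex set of the invaded tree after `n` steps of invasion percolation. -/
def invasion (X : List ℕ → ℕ) (w : List ℕ → ℝ) : ℕ → Set (List ℕ)
  | 0 => {[]}
  | n + 1 => invasion X w n ∪ argminBoundary X w (invasion X w n)

/-- The vertex set of the invasion percolation cluster. -/
def cluster (X : List ℕ → ℕ) (w : List ℕ → ℝ) : Set (List ℕ) :=
  ⋃ n, invasion X w n

/-- `b` is an infinite path from the root in the invasion percolation cluster. -/
def IsBackbone (X : List ℕ → ℕ) (w : List ℕ → ℝ) (b : ℕ → List ℕ) : Prop :=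
  b 0 = [] ∧ (∀ k, ∃ i : ℕ, b (k + 1) = i :: b k) ∧ ∀ k, b k ∈ cluster X w

open Classical in
/-- The backbone of the invasion percolation cluster (arbitrary value if there is none). -/
noncomputable def backbone (X : List ℕ → ℕ) (w : List ℕ → ℝ) : ℕ → List ℕ :=
  if h : ∃ b, IsBackbone X w b then h.choose else fun _ => []

/-- The future maximum weight `W_k = max_{i > k} β_i`, where `β_i` is the weight of the edge between
the backbone vertices `i - 1` and `i`. -/
noncomputable def futureMax (X : List ℕ → ℕ) (w : List ℕ → ℝ) (k : ℕ) : ℝ :=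
  sSup ((fun i => w (backbone X w i)) '' Set.Ioi k)

/-- The vertex set of the `k`-cut cluster: the component of the root in the cluster once the edge
between the backbone vertices `k` and `k + 1` is removed, i.e. the vertices of the cluster that do
not descend from the backbone vertex `k + 1`. -/
def cut (X : List ℕ → ℕ) (w : List ℕ → ℝ) (k : ℕ) : Set (List ℕ) :=
  {v | v ∈ cluster X w ∧ ¬ backbone X w (k + 1) <:+ v}

/-- The cumulative weight `C_k` of the edges of the `k`-cut cluster; its edges are those
joining its vertices other than the root to their parents. -/
noncomputable def cutWeight (X : List ℕ → ℕ) (w : List ℕ → ℝ) (k : ℕ) : ℝ :=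
  ∑' v : {v // v ∈ cut X w k ∧ v ≠ []}, w v

/-- `B_k = C_k - C_{k-1}`, with `C_{-1} = 0`. -/
noncomputable def B (X : List ℕ → ℕ) (w : List ℕ → ℝ) : ℕ → ℝ
  | 0 => cutWeight X w 0
  | k + 1 => cutWeight X w (k + 1) - cutWeight X w k

/-- The vertices of the cluster attached via the backbone vertex `k` (that vertex included):
the vertices of the `k`-cut cluster that are not in the `(k-1)`-cut cluster. -/
def attached (X : List ℕ → ℕ) (w : List ℕ → ℝ) : ℕ → Set (List ℕ)
  | 0 => cut X w 0
  | k + 1 => cut X w (k + 1) \ cut X w k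

/-- The cumulative weight of the edges of the forest attached to the backbone vertex `k`, without
the backbone edge that leads to that vertex. -/
noncomputable def forestWeight (X : List ℕ → ℕ) (w : List ℕ → ℝ) (k : ℕ) : ℝ :=
  ∑' v : {v // v ∈ attached X w k ∧ v ≠ backbone X w k}, w v

/-! Probabilistic part. -/

/-- A branching process tree with offspring law `ν` and i.i.d. standard uniform edge weights: all the
offspring numbers `X v` and weights `w v` are mutually independent. -/
structure IsWeightedBPTree {Ω : Type*} [MeasurableSpace Ω] (P : Measure Ω) (ν : Measure ℕ)
    (X : List ℕ → Ω → ℕ) (w : List ℕ → Ω → ℝ) : Prop where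
  measurable_offspring : ∀ v, Measurable (X v)
  measurable_weight : ∀ v, Measurable (w v)
  law_offspring : ∀ v, P.map (X v) = ν
  law_weight : ∀ v, P.map (w v) = volume.restrict (Set.Icc (0 : ℝ) 1)
  indep_offspring : iIndepFun X P
  indep_weight : iIndepFun w P
  indep : IndepFun (fun ω v => X v ω) (fun ω v => w v ω) P

/-- The random variables `Y i` are independent conditionally on `Z = z`, for almost every value `z` of
`Z`: under the regular conditional law of the sequence `Y` given `Z = z`, the coordinates are
mutually independent. -/
def CondIndepGiven {Ω : Type*} [MeasurableSpace Ω] (P : Measure Ω) [IsFiniteMeasure P]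
    (Y : Ω → ℕ → ℝ) (Z : Ω → ℕ → ℝ) : Prop :=
  AEMeasurable Y P ∧ AEMeasurable Z P ∧
    ∀ᵐ z ∂(P.map Z), iIndepFun (fun (i : ℕ) (y : ℕ → ℝ) => y i) (condDistrib Y Z P z)

end IPC

/-! The percolation threshold of a vertex is almost surely attained through exactly one of its
children, because thresholds have no atoms: the percolation probability `θ` at level `p` satisfies
`θ = 1 - E[(1 - p θ) ^ X]`, and by strict concavity of the right-hand side in `θ` it depends
continuously on `p > 0`. The backbone follows these best children, `W_k` is the threshold of the
backbone vertex `v_k`, and the forest at `v_k` consists of the clusters at level `W_k` below the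
other children.

The law of the subtree of the best child, weighted by any function of the forest at the root, has a
density with respect to the law of the whole tree that depends only on the gate of that subtree,
i.e. on the larger of its threshold and the weight of the edge leading to it. Hence, given its gate,
this subtree is distributed like the whole tree given its gate, independently of the forest.
Iterating along the backbone makes the forests and the backbone edges conditionally independent
given the thresholds. -/

namespace IPC

open scoped ENNReal

/-! ### Product measures and independence -/

section Product

variable {Ω ι E F : Type*} [MeasurableSpace E] [MeasurableSpace F]

lemma comap_pi_le_iSup {α : Type*} (f : ι → Ω → E) (a : α → ι) :
    MeasurableSpace.comap (fun ω x => f (a x) ω) MeasurableSpace.pi ≤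
      ⨆ i ∈ Set.range a, MeasurableSpace.comap (f i) inferInstance := by
  rw [MeasurableSpace.pi, MeasurableSpace.comap_iSup]
  refine iSup_le fun x => ?_
  rw [MeasurableSpace.comap_comp]
  exact le_iSup₂_of_le (f := fun i (_ : i ∈ Set.range a) => MeasurableSpace.comap (f i) _)
    (a x) ⟨x, rfl⟩ le_rfl

lemma indepFun_of_disjoint_range {α β : Type*} [MeasurableSpace Ω] {P : Measure Ω}
    {f : ι → Ω → E} (hf : iIndepFun f P) (hm : ∀ i, Measurable (f i)) {a : α → ι} {b : β → ι}
    (hab : Disjoint (Set.range a) (Set.range b)) :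
    IndepFun (fun ω x => f (a x) ω) (fun ω y => f (b y) ω) P :=
  indep_of_indep_of_le_left
    (indep_of_indep_of_le_right
      (indep_iSup_of_disjoint (fun i => (hm i).comap_le) hf.iIndep hab) (comap_pi_le_iSup f b))
    (comap_pi_le_iSup f a)

lemma infinitePi_prod_infinitePi_map_prodMk (μ : ι → Measure E) (ρ : ι → Measure F)
    [∀ i, IsProbabilityMeasure (μ i)] [∀ i, IsProbabilityMeasure (ρ i)] :
    ((Measure.infinitePi μ).prod (Measure.infinitePi ρ)).map (fun p i => (p.1 i, p.2 i)) =
      Measure.infinitePi fun i => (μ i).prod (ρ i) := by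
  refine Measure.eq_infinitePi _ fun s A hA => ?_
  have hbox : MeasurableSet (Set.pi s A) := .pi s.countable_toSet fun i _ => hA i
  have hsec : ∀ i, Measurable fun x : E => ρ i (Prod.mk x ⁻¹' A i) := fun i =>
    measurable_measure_prodMk_left (hA i)
  have hind : iIndepFun (fun i (x : ι → E) => ρ i (Prod.mk (x i) ⁻¹' A i))
      (Measure.infinitePi μ) := iIndepFun_infinitePi hsec
  calc ((Measure.infinitePi μ).prod (Measure.infinitePi ρ)).map
        (fun p i => (p.1 i, p.2 i)) (Set.pi s A)
      = ∫⁻ x, Measure.infinitePi ρ (Set.pi s fun i => Prod.mk (x i) ⁻¹' A i)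
          ∂Measure.infinitePi μ := by
        rw [Measure.map_apply (by fun_prop) hbox,
          Measure.prod_apply ((show Measurable fun (p : (ι → E) × (ι → F)) i => (p.1 i, p.2 i) by
            fun_prop) hbox)]
        rfl
    _ = ∫⁻ x, ∏ i ∈ s, ρ i (Prod.mk (x i) ⁻¹' A i) ∂Measure.infinitePi μ :=
        lintegral_congr fun x => Measure.infinitePi_pi ρ fun i _ => measurable_prodMk_left (hA i)
    _ = ∏ i ∈ s, ∫⁻ x, ρ i (Prod.mk (x i) ⁻¹' A i) ∂Measure.infinitePi μ :=
        lintegral_prod_eq_prod_lintegral_of_indepFun s _ hind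
          fun i => (hsec i).comp (measurable_pi_apply i)
    _ = ∏ i ∈ s, ((μ i).prod (ρ i)) (A i) := by
        refine Finset.prod_congr rfl fun i _ => ?_
        rw [Measure.prod_apply (hA i),
          (measurePreserving_eval_infinitePi μ i).lintegral_comp (hsec i)]

variable [DecidableEq ι]

lemma measurable_update_prod (i : ι) :
    Measurable (fun p : (ι → E) × E => Function.update p.1 i p.2) := by
  refine measurable_pi_iff.2 fun j => ?_
  by_cases h : j = i
  · subst h; simpa only [Function.update_self] using measurable_snd
  · simp only [Function.update_of_ne h]; fun_prop

lemma infinitePi_prod_map_update (μ : ι → Measure E) [∀ i, IsProbabilityMeasure (μ i)] (i : ι) :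
    ((Measure.infinitePi μ).prod (μ i)).map (fun p => Function.update p.1 i p.2) =
      Measure.infinitePi μ := by
  refine Measure.eq_infinitePi _ fun s A hA => ?_
  have hpre : (fun p : (ι → E) × E => Function.update p.1 i p.2) ⁻¹' (Set.pi s A) =
      (Set.pi (s.erase i : Finset ι) A) ×ˢ (if i ∈ s then A i else Set.univ) := by
    ext p
    simp only [Set.mem_preimage, Set.mem_pi, Set.mem_prod, Finset.mem_coe, Finset.mem_erase]
    grind [Function.update_apply]
  rw [Measure.map_apply (measurable_update_prod i) (.pi s.countable_toSet fun j _ => hA j), hpre,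
    Measure.prod_prod, Measure.infinitePi_pi _ fun j _ => hA j]
  split_ifs with his
  · exact Finset.prod_erase_mul _ _ his
  · rw [measure_univ, mul_one, Finset.erase_eq_of_notMem his]

lemma lintegral_infinitePi_update (μ : ι → Measure E) [∀ i, IsProbabilityMeasure (μ i)] (i : ι)
    {H : (ι → E) → ℝ≥0∞} (hH : Measurable H) :
    ∫⁻ x, H x ∂Measure.infinitePi μ =
      ∫⁻ x, ∫⁻ y, H (Function.update x i y) ∂μ i ∂Measure.infinitePi μ := by
  conv_lhs => rw [← infinitePi_prod_map_update μ i]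
  rw [lintegral_map hH (measurable_update_prod i),
    lintegral_prod (fun p : (ι → E) × E => H (Function.update p.1 i p.2))
      (hH.comp (measurable_update_prod i)).aemeasurable]

end Product

/-! ### Conditional distributions and a criterion for conditional independence -/

section CondDistrib

variable {Ω α β γ : Type*} [MeasurableSpace Ω] [MeasurableSpace α] [StandardBorelSpace α]
  [Nonempty α] [MeasurableSpace β] [MeasurableSpace γ] {P : Measure Ω} [IsFiniteMeasure P]
  {A : Ω → α} {B : Ω → β} {C : Ω → γ}

lemma lintegral_lintegral_condDistrib (hA : Measurable A) (hC : Measurable C) {g : γ × α → ℝ≥0∞}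
    (hg : Measurable g) :
    ∫⁻ ω, ∫⁻ a, g (C ω, a) ∂condDistrib A C P (C ω) ∂P = ∫⁻ ω, g (C ω, A ω) ∂P := by
  rw [← lintegral_map hg (hC.prodMk hA), ← compProd_map_condDistrib hA.aemeasurable,
    Measure.lintegral_compProd hg, lintegral_map hg.lintegral_kernel_prod_right' hC]

/-- If `B` has law `η (C ω)` conditionally on `A` and `C`, then `A` is independent of `B` given `C`,
so that a function of `A` may be replaced with its conditional mean given `C`. -/
lemma lintegral_mul_eq_of_kernel (hA : Measurable A) (hC : Measurable C) (η : Kernel γ β)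
    [IsSFiniteKernel η]
    (h : ∀ a : α → ℝ≥0∞, Measurable a → ∀ b : γ × β → ℝ≥0∞, Measurable b →
      ∫⁻ ω, a (A ω) * b (C ω, B ω) ∂P = ∫⁻ ω, a (A ω) * ∫⁻ x, b (C ω, x) ∂η (C ω) ∂P)
    {a : α → ℝ≥0∞} (ha : Measurable a) {b : γ × β → ℝ≥0∞} (hb : Measurable b) :
    ∫⁻ ω, a (A ω) * b (C ω, B ω) ∂P =
      ∫⁻ ω, (∫⁻ x, a x ∂condDistrib A C P (C ω)) * b (C ω, B ω) ∂P := by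
  have hmean : Measurable fun c => ∫⁻ x, a x ∂condDistrib A C P c := ha.lintegral_kernel
  have hG : Measurable fun c => ∫⁻ x, b (c, x) ∂η c := hb.lintegral_kernel_prod_right'
  calc ∫⁻ ω, a (A ω) * b (C ω, B ω) ∂P
      = ∫⁻ ω, (∫⁻ x, b (C ω, x) ∂η (C ω)) * a (A ω) ∂P := by
        simp only [h a ha b hb, mul_comm]
    _ = ∫⁻ ω, (∫⁻ x, b (C ω, x) ∂η (C ω)) * ∫⁻ x, a x ∂condDistrib A C P (C ω) ∂P := by
        rw [← lintegral_lintegral_condDistrib hA hC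
          (g := fun p => (∫⁻ x, b (p.1, x) ∂η p.1) * a p.2)
          ((hG.comp measurable_fst).mul (ha.comp measurable_snd))]
        simp only [lintegral_const_mul _ ha]
    _ = ∫⁻ ω, (∫⁻ x, a x ∂condDistrib A C P (C ω)) * b (C ω, B ω) ∂P := by
        have := h (fun _ => 1) measurable_const
          (fun p => (∫⁻ x, a x ∂condDistrib A C P p.1) * b p)
          ((hmean.comp measurable_fst).mul hb)
        simp only [one_mul] at this
        rw [this]
        refine lintegral_congr fun ω => ?_
        exact (mul_comm _ _).trans
          (lintegral_const_mul _ (hb.comp measurable_prodMk_left)).symm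

end CondDistrib

section Criterion

variable {ι : Type*}

lemma iIndepFun_eval_of_measure_pi_Iio (μ : Measure (ι → ℝ))
    (h : ∀ (S : Finset ι) (q : ι →₀ ℚ), μ (Set.pi S fun i => Set.Iio (q i : ℝ)) =
      ∏ i ∈ S, μ ((fun y => y i) ⁻¹' Set.Iio (q i : ℝ))) :
    iIndepFun (fun (i : ι) (y : ι → ℝ) => y i) μ := by
  classical
  rw [iIndepFun_iff_iIndep]
  refine iIndepSets.iIndep
    (π := fun i => {s | ∃ q : ℚ, s = (fun y : ι → ℝ => y i) ⁻¹' Set.Iio (q : ℝ)})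
    (fun i => (measurable_pi_apply i).comap_le) ?_ (fun i => ?_) ?_
  · rintro i _ ⟨q, rfl⟩ _ ⟨q', rfl⟩ -
    refine ⟨min q q', ?_⟩
    rw [← Set.preimage_inter, Set.Iio_inter_Iio, Rat.cast_min]
  · rw [BorelSpace.measurable_eq (α := ℝ), Real.borel_eq_generateFrom_Iio_rat,
      MeasurableSpace.comap_generateFrom]
    congr 1
    ext s
    simp only [Set.mem_image, Set.mem_iUnion, Set.mem_singleton_iff, Set.mem_ofPred_eq]
    constructor
    · rintro ⟨_, ⟨q, rfl⟩, rfl⟩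
      exact ⟨q, rfl⟩
    · rintro ⟨q, rfl⟩
      exact ⟨_, ⟨q, rfl⟩, rfl⟩
  · rw [iIndepSets_iff]
    intro S f hf
    choose! q hq using hf
    have hbox : ⋂ i ∈ S, f i =
        Set.pi S fun i => Set.Iio ((Finsupp.indicator S fun i _ => q i) i : ℝ) := by
      ext y
      simp only [Set.mem_iInter, Set.mem_pi, Finset.mem_coe]
      refine forall₂_congr fun i hi => ?_
      rw [hq i hi, Finsupp.indicator_of_mem hi]
      rfl
    rw [hbox, h]
    refine Finset.prod_congr rfl fun i hi => ?_
    rw [hq i hi, Finsupp.indicator_of_mem hi]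

variable [Countable ι] {Ω β : Type*} [MeasurableSpace Ω] [MeasurableSpace β] {P : Measure Ω}
  [IsProbabilityMeasure P] {V : Ω → ι → ℝ} {Z : Ω → β} {φ : ι → Set ℝ → β → ℝ≥0∞}

lemma condDistrib_pi_ae_eq_prod (hV : Measurable V) (hZ : Measurable Z) {S : Finset ι}
    {A : ι → Set ℝ} (hA : ∀ i, MeasurableSet (A i)) {φ : ι → β → ℝ≥0∞} (hφ : ∀ i, Measurable (φ i))
    (h : ∀ D, MeasurableSet D →
      P (Z ⁻¹' D ∩ V ⁻¹' (Set.pi S A)) = ∫⁻ ω in Z ⁻¹' D, ∏ i ∈ S, φ i (Z ω) ∂P) :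
    ∀ᵐ z ∂(P.map Z), condDistrib V Z P z (Set.pi S A) = ∏ i ∈ S, φ i z := by
  have : IsProbabilityMeasure (P.map Z) := Measure.isProbabilityMeasure_map hZ.aemeasurable
  have hS : MeasurableSet (Set.pi (S : Set ι) A) := .pi S.countable_toSet fun j _ => hA j
  have hprod : Measurable fun z => ∏ i ∈ S, φ i z := Finset.measurable_prod _ fun i _ => hφ i
  refine ae_eq_of_forall_setLIntegral_eq_of_sigmaFinite (Kernel.measurable_coe _ hS) hprod
    fun D hD _ => ?_
  rw [setLIntegral_map hD (Kernel.measurable_coe _ hS) hZ, setLIntegral_map hD hprod hZ,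
    setLIntegral_preimage_condDistrib hZ hV.aemeasurable hS hD, h D hD]

/-- It suffices that, jointly with `Z`, the probabilities of boxes factor through *some* functions
`φ i (A i)` of `Z`: boxes with one side then identify `φ i (A i)` as a conditional probability. -/
lemma ae_iIndepFun_condDistrib (hV : Measurable V) (hZ : Measurable Z)
    (hφ : ∀ i A, MeasurableSet A → Measurable (φ i A))
    (h : ∀ (S : Finset ι) (A : ι → Set ℝ), (∀ i, MeasurableSet (A i)) → ∀ D, MeasurableSet D →
      P (Z ⁻¹' D ∩ V ⁻¹' (Set.pi S A)) = ∫⁻ ω in Z ⁻¹' D, ∏ i ∈ S, φ i (A i) (Z ω) ∂P) :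
    ∀ᵐ z ∂(P.map Z), iIndepFun (fun (i : ι) (y : ι → ℝ) => y i) (condDistrib V Z P z) := by
  have hbox : ∀ (S : Finset ι) (A : ι → Set ℝ), (∀ i, MeasurableSet (A i)) →
      ∀ᵐ z ∂(P.map Z), condDistrib V Z P z (Set.pi S A) = ∏ i ∈ S, φ i (A i) z :=
    fun S A hA => condDistrib_pi_ae_eq_prod hV hZ hA (fun i => hφ i _ (hA i)) (h S A hA)
  have hside : ∀ᵐ z ∂(P.map Z), ∀ (i : ι) (q : ℚ),
      condDistrib V Z P z ((fun y => y i) ⁻¹' Set.Iio (q : ℝ)) = φ i (Set.Iio (q : ℝ)) z := by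
    refine ae_all_iff.2 fun i => ae_all_iff.2 fun q => ?_
    filter_upwards [hbox {i} (fun _ => Set.Iio (q : ℝ)) fun _ => measurableSet_Iio] with z hz
    rwa [Finset.coe_singleton, Set.singleton_pi, Finset.prod_singleton] at hz
  have hrat : ∀ᵐ z ∂(P.map Z), ∀ (S : Finset ι) (q : ι →₀ ℚ),
      condDistrib V Z P z (Set.pi S fun i => Set.Iio (q i : ℝ)) =
        ∏ i ∈ S, φ i (Set.Iio (q i : ℝ)) z :=
    ae_all_iff.2 fun S => ae_all_iff.2 fun q => hbox S _ fun _ => measurableSet_Iio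
  filter_upwards [hrat, hside] with z hz hz'
  refine iIndepFun_eval_of_measure_pi_Iio _ fun S q => ?_
  rw [hz S q]
  exact Finset.prod_congr rfl fun i _ => (hz' i (q i)).symm

end Criterion

/-! ### Thresholds, best children and forests -/

section Trees

/-- A weighted tree in Ulam–Harris coding: each vertex carries its number of children and the weight
of the edge to its parent. Vertices outside the tree carry data as well, which makes the vertex data
an i.i.d. family. -/
abbrev WTree : Type := List ℕ → ℕ × ℝ≥0∞

/-- The tree of the descendants of `v`. -/
def subtree (v : List ℕ) (t : WTree) : WTree := fun u => t (u ++ v)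

/-- The least `p` for which there is a path of length `n` from the root with all weights `≤ p`. -/
noncomputable def level : ℕ → WTree → ℝ≥0∞
  | 0, _ => 0
  | n + 1, t =>
    (Finset.range (t []).1).inf fun i => max (subtree [i] t []).2 (level n (subtree [i] t))

/-- The percolation threshold of the root: the infimum of the levels `p` at which the root is in an
infinite cluster. -/
noncomputable def threshold (t : WTree) : ℝ≥0∞ := ⨆ n, level n t

/-- The percolation threshold of the parent of the root through the root. -/
noncomputable def gate (t : WTree) : ℝ≥0∞ := max (t []).2 (threshold t)

/-- `i` is the unique child of the root through which the threshold of the root is attained. -/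
def IsBestChild (t : WTree) (i : ℕ) : Prop :=
  i < (t []).1 ∧ ∀ j < (t []).1, j ≠ i → gate (subtree [i] t) < gate (subtree [j] t)

/-- The child of the root through which the threshold is attained, `0` if it is not unique. -/
noncomputable def bestChild (t : WTree) : ℕ := sInf {i | IsBestChild t i}

/-- The tree of the descendants of the best child. -/
noncomputable def next (t : WTree) : WTree := subtree [bestChild t] t

/-- All the edges from the parent of the root to `s` are present and have weight at most `z`. -/
def PathBelow (z : ℝ≥0∞) (t : WTree) : List ℕ → Prop
  | [] => (t []).2 ≤ z
  | i :: s => PathBelow z t s ∧ i < (t s).1 ∧ (t (i :: s)).2 ≤ z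

open Classical in
/-- The weight of the part of the cluster at level `z` of the parent of the root that lies inside
the tree. -/
noncomputable def clusterWeight (z : ℝ≥0∞) (t : WTree) : ℝ≥0∞ :=
  ∑' s, if PathBelow z t s then (t s).2 else 0

/-- The weight of the clusters at level `z` hanging off a vertex with `x` children and subtrees `ξ`,
the `i`-th child excepted. -/
noncomputable def hangingWeight (z : ℝ≥0∞) (i x : ℕ) (ξ : ℕ → WTree) : ℝ≥0∞ :=
  ∑ j ∈ (Finset.range x).erase i, clusterWeight z (ξ j)

/-- The weight of the forest hanging off the root, without the best child. -/
noncomputable def forest (t : WTree) : ℝ≥0∞ :=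
  hangingWeight (threshold t) (bestChild t) (t []).1 fun j => subtree [j] t

lemma level_le_level_succ (n : ℕ) (t : WTree) : level n t ≤ level (n + 1) t := by
  induction n generalizing t with
  | zero => exact zero_le
  | succ n ih => exact Finset.inf_mono_fun fun i _ => max_le_max le_rfl (ih _)

lemma monotone_level (t : WTree) : Monotone fun n => level n t :=
  monotone_nat_of_le_succ fun n => level_le_level_succ n t

lemma level_le_threshold (n : ℕ) (t : WTree) : level n t ≤ threshold t :=
  le_iSup (fun n => level n t) n

lemma threshold_eq_inf (t : WTree) :
    threshold t = (Finset.range (t []).1).inf fun i => gate (subtree [i] t) := by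
  apply le_antisymm
  · refine iSup_le fun n => (level_le_level_succ n t).trans ?_
    exact Finset.inf_mono_fun fun i _ => max_le_max le_rfl (level_le_threshold n _)
  · refine le_of_forall_lt fun b hb => ?_
    have hb' : b < ⊤ := hb.trans_le le_top
    rw [Finset.lt_inf_iff hb'] at hb
    have hlevel : ∀ i ∈ Finset.range (t []).1,
        ∃ n, b < max (subtree [i] t []).2 (level n (subtree [i] t)) := by
      intro i hi
      rcases lt_max_iff.1 (hb i hi) with h | h
      · exact ⟨0, lt_max_of_lt_left h⟩
      · obtain ⟨n, hn⟩ := lt_iSup_iff.1 h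
        exact ⟨n, lt_max_of_lt_right hn⟩
    choose! n hn using hlevel
    refine lt_of_lt_of_le ?_ (level_le_threshold ((Finset.range (t []).1).sup n + 1) t)
    rw [level, Finset.lt_inf_iff hb']
    exact fun i hi =>
      (hn i hi).trans_le (max_le_max le_rfl (monotone_level _ (Finset.le_sup (f := n) hi)))

lemma threshold_le_gate {t : WTree} {i : ℕ} (hi : i < (t []).1) :
    threshold t ≤ gate (subtree [i] t) := by
  rw [threshold_eq_inf]
  exact Finset.inf_le (Finset.mem_range.2 hi)

lemma IsBestChild.threshold_eq {t : WTree} {i : ℕ} (h : IsBestChild t i) :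
    threshold t = gate (subtree [i] t) := by
  refine le_antisymm (threshold_le_gate h.1) ?_
  rw [threshold_eq_inf]
  refine Finset.le_inf fun j hj => ?_
  by_cases hji : j = i
  · rw [hji]
  · exact (h.2 j (Finset.mem_range.1 hj) hji).le

lemma IsBestChild.unique {t : WTree} {i j : ℕ} (hi : IsBestChild t i) (hj : IsBestChild t j) :
    i = j := by
  by_contra h
  exact lt_asymm (hi.2 j hj.1 (Ne.symm h)) (hj.2 i hi.1 h)

lemma IsBestChild.bestChild_eq {t : WTree} {i : ℕ} (h : IsBestChild t i) : bestChild t = i :=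
  (Nat.sInf_mem (s := {i | IsBestChild t i}) ⟨i, h⟩ : IsBestChild t (bestChild t)).unique h

lemma bestChild_eq_zero {t : WTree} (h : ∀ i, ¬ IsBestChild t i) : bestChild t = 0 := by
  rw [bestChild, Set.eq_empty_of_forall_notMem (s := {i | IsBestChild t i}) h, Nat.sInf_empty]

lemma bestChild_eq_iff (t : WTree) (i : ℕ) :
    bestChild t = i ↔ IsBestChild t i ∨ (i = 0 ∧ ∀ j, ¬ IsBestChild t j) := by
  constructor
  · rintro rfl
    by_cases h : ∃ j, IsBestChild t j
    · exact .inl (Nat.sInf_mem h)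
    · exact .inr ⟨bestChild_eq_zero (not_exists.1 h), not_exists.1 h⟩
  · rintro (h | ⟨rfl, h⟩)
    · exact h.bestChild_eq
    · exact bestChild_eq_zero h

@[fun_prop]
lemma measurable_subtree (v : List ℕ) : Measurable (subtree v) :=
  measurable_pi_iff.2 fun u => measurable_pi_apply (u ++ v)

@[fun_prop]
lemma measurable_offspring : Measurable fun t : WTree => (t []).1 := by fun_prop

lemma measurable_inf_range {α : Type*} [MeasurableSpace α] {x : α → ℕ} (hx : Measurable x)
    {f : ℕ → α → ℝ≥0∞} (hf : ∀ i, Measurable (f i)) :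
    Measurable fun a => (Finset.range (x a)).inf fun i => f i a := by
  have : Measurable fun p : ℕ × α => (Finset.range p.1).inf fun i => f i p.2 := by
    refine measurable_from_prod_countable_right fun n => ?_
    change Measurable fun a => (Finset.range n).inf fun i => f i a
    induction n with
    | zero => simp
    | succ n ih =>
      simp only [Finset.range_add_one, Finset.inf_insert]
      exact (hf n).inf ih
  exact this.comp (hx.prodMk measurable_id)

@[fun_prop]
lemma measurable_level (n : ℕ) : Measurable (level n) := by
  induction n with
  | zero => exact measurable_const
  | succ n ih =>
    exact measurable_inf_range measurable_offspring fun i => by fun_prop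

@[fun_prop]
lemma measurable_threshold : Measurable threshold := Measurable.iSup measurable_level

@[fun_prop]
lemma measurable_gate : Measurable gate := by unfold gate; fun_prop

lemma measurableSet_forall_ne_lt_gate (i : ℕ) :
    MeasurableSet {q : ℝ≥0∞ × (ℕ × ℝ≥0∞) × (ℕ → WTree) |
      i < q.2.1.1 ∧ ∀ j < q.2.1.1, j ≠ i → q.1 < gate (q.2.2 j)} := by
  have : {q : ℝ≥0∞ × (ℕ × ℝ≥0∞) × (ℕ → WTree) |
        i < q.2.1.1 ∧ ∀ j < q.2.1.1, j ≠ i → q.1 < gate (q.2.2 j)} =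
      {q | i < q.2.1.1} ∩
        ⋂ j, ({q | j < q.2.1.1}ᶜ ∪ {_q | j = i} ∪ {q | q.1 < gate (q.2.2 j)}) := by
    ext q
    simp only [Set.mem_ofPred_eq, Set.mem_inter_iff, Set.mem_iInter, Set.mem_union,
      Set.mem_compl_iff]
    refine and_congr_right fun _ => forall_congr' fun j => ?_
    tauto
  rw [this]
  exact (measurableSet_lt measurable_const (by fun_prop)).inter (.iInter fun j =>
    ((measurableSet_lt measurable_const (by fun_prop)).compl.union (.const _)).union
      (measurableSet_lt (by fun_prop) (by fun_prop)))

lemma measurableSet_isBestChild (i : ℕ) : MeasurableSet {t | IsBestChild t i} :=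
  (measurableSet_forall_ne_lt_gate i).preimage
    (f := fun t : WTree => (gate (subtree [i] t), t [], fun j => subtree [j] t)) (by fun_prop)

@[fun_prop]
lemma measurable_bestChild : Measurable bestChild := by
  refine measurable_to_countable' fun i => ?_
  have : bestChild ⁻¹' {i} = {t | IsBestChild t i} ∪
      ({_t | i = 0} ∩ ⋂ j, {t | IsBestChild t j}ᶜ) := by
    ext t
    simp only [Set.mem_preimage, Set.mem_singleton_iff, bestChild_eq_iff, Set.mem_union,
      Set.mem_inter_iff, Set.mem_ofPred_eq, Set.mem_iInter, Set.mem_compl_iff]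
  rw [this]
  exact (measurableSet_isBestChild i).union
    ((MeasurableSet.const _).inter (.iInter fun j => (measurableSet_isBestChild j).compl))

@[fun_prop]
lemma measurable_next : Measurable next := by
  have : Measurable fun p : ℕ × WTree => subtree [p.1] p.2 :=
    measurable_from_prod_countable_right fun n => measurable_subtree [n]
  exact this.comp (measurable_bestChild.prodMk measurable_id)

lemma measurableSet_pathBelow (s : List ℕ) :
    MeasurableSet {p : ℝ≥0∞ × WTree | PathBelow p.1 p.2 s} := by
  induction s with
  | nil =>
    change MeasurableSet {p : ℝ≥0∞ × WTree | (p.2 []).2 ≤ p.1}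
    exact measurableSet_le (by fun_prop) measurable_fst
  | cons i s ih =>
    refine ih.inter ((?_ : MeasurableSet {p : ℝ≥0∞ × WTree | i < (p.2 s).1}).inter
      (?_ : MeasurableSet {p : ℝ≥0∞ × WTree | (p.2 (i :: s)).2 ≤ p.1}))
    · exact measurableSet_lt measurable_const (by fun_prop)
    · exact measurableSet_le (by fun_prop) measurable_fst

lemma measurable_clusterWeight :
    Measurable fun p : ℝ≥0∞ × WTree => clusterWeight p.1 p.2 := by
  classical
  unfold clusterWeight
  refine Measurable.tsum fun s => ?_
  exact Measurable.ite (measurableSet_pathBelow s) (by fun_prop) measurable_const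

lemma measurable_hangingWeight :
    Measurable fun p : ((ℝ≥0∞ × ℕ) × ℕ) × (ℕ → WTree) =>
      hangingWeight p.1.1.1 p.1.1.2 p.1.2 p.2 := by
  have : ∀ i x : ℕ, Measurable fun p : ℝ≥0∞ × (ℕ → WTree) => hangingWeight p.1 i x p.2 := by
    intro i x
    exact Finset.measurable_sum _ fun j _ => measurable_clusterWeight.comp
      (f := fun p : ℝ≥0∞ × (ℕ → WTree) => (p.1, p.2 j)) (by fun_prop)
  have h : Measurable fun q : (ℕ × ℕ) × (ℝ≥0∞ × (ℕ → WTree)) =>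
      hangingWeight q.2.1 q.1.1 q.1.2 q.2.2 :=
    measurable_from_prod_countable_right fun n => this n.1 n.2
  exact h.comp (g := fun q : (ℕ × ℕ) × (ℝ≥0∞ × (ℕ → WTree)) =>
    hangingWeight q.2.1 q.1.1 q.1.2 q.2.2)
    (f := fun p : ((ℝ≥0∞ × ℕ) × ℕ) × (ℕ → WTree) => ((p.1.1.2, p.1.2), (p.1.1.1, p.2)))
    (by fun_prop)

@[fun_prop]
lemma measurable_forest : Measurable forest :=
  measurable_hangingWeight.comp (f := fun t : WTree =>
    (((threshold t, bestChild t), (t []).1), fun j => subtree [j] t)) (by fun_prop)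

end Trees

/-! ### The law of a branching process tree -/

section Law

/-- The law of the tree with i.i.d. vertex data. -/
noncomputable def treeLaw (η : Measure (ℕ × ℝ≥0∞)) : Measure WTree :=
  Measure.infinitePi fun _ : List ℕ => η

variable (η : Measure (ℕ × ℝ≥0∞)) [IsProbabilityMeasure η]

instance : IsProbabilityMeasure (treeLaw η) := by unfold treeLaw; infer_instance

lemma measurePreserving_subtree (v : List ℕ) :
    MeasurePreserving (subtree v) (treeLaw η) (treeLaw η) where
  measurable := measurable_subtree v
  map_eq := Measure.map_infinitePi_infinitePi_of_inj (f := fun u : List ℕ => u ++ v)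
    (P := fun _ => η) fun _ _ h => List.append_cancel_right h

lemma iIndepFun_vertex : iIndepFun (fun (v : List ℕ) (t : WTree) => t v) (treeLaw η) :=
  iIndepFun_infinitePi (X := fun _ x => x) fun _ => measurable_id

lemma map_root_subtrees :
    (treeLaw η).map (fun t => (t [], fun i => subtree [i] t)) =
      η.prod (Measure.infinitePi fun _ : ℕ => treeLaw η) := by
  have hdisj : Disjoint (Set.range fun _ : Unit => ([] : List ℕ))
      (Set.range fun p : ℕ × List ℕ => p.2 ++ [p.1]) := by
    rw [Set.disjoint_left]
    rintro _ ⟨_, rfl⟩ ⟨p, hp⟩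
    exact List.append_ne_nil_of_right_ne_nil _ (List.cons_ne_nil _ _) hp
  have hindep : IndepFun (fun t : WTree => t []) (fun (t : WTree) i => subtree [i] t)
      (treeLaw η) :=
    (indepFun_of_disjoint_range (iIndepFun_vertex η) measurable_pi_apply hdisj).comp
      (measurable_pi_apply ())
      (MeasurableEquiv.curry ℕ (List ℕ) (ℕ × ℝ≥0∞)).measurable
  have hinj : Function.Injective fun p : ℕ × List ℕ => p.2 ++ [p.1] := by
    rintro ⟨i, u⟩ ⟨j, v⟩ h
    obtain ⟨rfl, hij⟩ := List.append_inj' h rfl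
    exact congrArg (·, u) (List.head_eq_of_cons_eq hij)
  have hsub : (treeLaw η).map (fun t i => subtree [i] t) =
      Measure.infinitePi fun _ : ℕ => treeLaw η := by
    change (treeLaw η).map ((MeasurableEquiv.curry ℕ (List ℕ) (ℕ × ℝ≥0∞)) ∘
      fun (t : WTree) (p : ℕ × List ℕ) => t (p.2 ++ [p.1])) = _
    rw [← Measure.map_map (by fun_prop) (by fun_prop), treeLaw,
      Measure.map_infinitePi_infinitePi_of_inj (P := fun _ => η) hinj]
    exact Measure.infinitePi_map_curry fun (_ : ℕ) (_ : List ℕ) => η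
  rw [(indepFun_iff_map_prod_eq_prod_map_map (Measurable.aemeasurable (by fun_prop))
    (Measurable.aemeasurable (by fun_prop))).1 hindep, hsub, treeLaw,
    Measure.infinitePi_map_eval (fun _ : List ℕ => η) []]

lemma lintegral_root_subtrees {H : (ℕ × ℝ≥0∞) × (ℕ → WTree) → ℝ≥0∞} (hH : Measurable H) :
    ∫⁻ t, H (t [], fun i => subtree [i] t) ∂treeLaw η =
      ∫⁻ p, H p ∂η.prod (Measure.infinitePi fun _ : ℕ => treeLaw η) := by
  rw [← map_root_subtrees, lintegral_map hH (by fun_prop)]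

lemma indepFun_subtree {i j : ℕ} (hij : i ≠ j) :
    IndepFun (subtree [i]) (subtree [j]) (treeLaw η) := by
  refine indepFun_of_disjoint_range (a := fun u => u ++ [i]) (b := fun u => u ++ [j])
    (iIndepFun_vertex η) measurable_pi_apply ?_
  rw [Set.disjoint_left]
  rintro _ ⟨u, rfl⟩ ⟨v, hv⟩
  exact hij (List.head_eq_of_cons_eq (List.append_inj' hv rfl).2).symm

lemma ae_ne_of_noAtoms {i j : ℕ} (hij : i ≠ j) {f g : WTree → ℝ≥0∞} (hf : Measurable f)
    (hg : Measurable g) (h : ∀ z, treeLaw η {t | f t = z} = 0) :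
    ∀ᵐ t ∂treeLaw η, f (subtree [i] t) ≠ g (subtree [j] t) := by
  have hs : MeasurableSet {p : WTree × WTree | f p.2 = g p.1} :=
    measurableSet_eq_fun (hf.comp measurable_snd) (hg.comp measurable_fst)
  have hlaw : (treeLaw η).map (fun t => (subtree [j] t, subtree [i] t)) =
      (treeLaw η).prod (treeLaw η) := by
    rw [(indepFun_iff_map_prod_eq_prod_map_map (measurable_subtree _).aemeasurable
      (measurable_subtree _).aemeasurable).1 (indepFun_subtree η hij.symm),
      (measurePreserving_subtree η [j]).map_eq, (measurePreserving_subtree η [i]).map_eq]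
  have hnull : ((treeLaw η).prod (treeLaw η)) {p : WTree × WTree | f p.2 = g p.1} = 0 := by
    rw [Measure.prod_apply hs]
    exact (lintegral_congr fun t => h (g t)).trans lintegral_zero
  rw [← hlaw, Measure.map_apply (by fun_prop) hs] at hnull
  exact measure_eq_zero_iff_ae_notMem.1 hnull

/-- The tree with the weight of the root replaced. -/
def setRoot (t : WTree) (u : ℝ≥0∞) : WTree := Function.update t [] ((t []).1, u)

lemma subtree_setRoot (i : ℕ) (t : WTree) (u : ℝ≥0∞) :
    subtree [i] (setRoot t u) = subtree [i] t := by
  funext s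
  exact Function.update_of_ne (List.append_ne_nil_of_right_ne_nil _ (List.cons_ne_nil _ _)) _ _

@[simp] lemma setRoot_nil (t : WTree) (u : ℝ≥0∞) : setRoot t u [] = ((t []).1, u) :=
  Function.update_self _ _ _

lemma level_setRoot (n : ℕ) (t : WTree) (u : ℝ≥0∞) : level n (setRoot t u) = level n t := by
  cases n with
  | zero => rfl
  | succ n => simp only [level, subtree_setRoot, setRoot_nil]

lemma threshold_setRoot (t : WTree) (u : ℝ≥0∞) : threshold (setRoot t u) = threshold t := by
  simp only [threshold, level_setRoot]

lemma gate_setRoot (t : WTree) (u : ℝ≥0∞) : gate (setRoot t u) = max u (threshold t) := by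
  rw [gate, threshold_setRoot, setRoot_nil]

lemma bestChild_setRoot (t : WTree) (u : ℝ≥0∞) : bestChild (setRoot t u) = bestChild t := by
  simp only [bestChild, IsBestChild, subtree_setRoot, setRoot_nil]

lemma next_setRoot (t : WTree) (u : ℝ≥0∞) : next (setRoot t u) = next t := by
  rw [next, bestChild_setRoot, subtree_setRoot, next]

lemma forest_setRoot (t : WTree) (u : ℝ≥0∞) : forest (setRoot t u) = forest t := by
  simp only [forest, threshold_setRoot, bestChild_setRoot, subtree_setRoot, setRoot_nil]

lemma measurable_setRoot : Measurable fun p : WTree × ℝ≥0∞ => setRoot p.1 p.2 :=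
  (measurable_update_prod []).comp
    (f := fun p : WTree × ℝ≥0∞ => (p.1, ((p.1 []).1, p.2))) (by fun_prop)

lemma lintegral_setRoot (ν : Measure ℕ) (lam : Measure ℝ≥0∞) [IsProbabilityMeasure ν]
    [IsProbabilityMeasure lam] {H : WTree → ℝ≥0∞} (hH : Measurable H) :
    ∫⁻ t, H t ∂treeLaw (ν.prod lam) =
      ∫⁻ u, ∫⁻ t, H (setRoot t u) ∂treeLaw (ν.prod lam) ∂lam := by
  have hset : Measurable fun p : WTree × ℝ≥0∞ => H (setRoot p.1 p.2) := hH.comp measurable_setRoot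
  have hroot : ∀ (t : WTree) (e : ℕ × ℝ≥0∞) (u : ℝ≥0∞),
      setRoot (Function.update t [] e) u = Function.update t [] (e.1, u) := fun t e u => by
    rw [setRoot, Function.update_self, Function.update_idem]
  have hresample : ∀ t : WTree, ∫⁻ e, H (Function.update t [] e) ∂ν.prod lam =
      ∫⁻ e, ∫⁻ u, H (setRoot (Function.update t [] e) u) ∂lam ∂ν.prod lam := fun t => by
    have hm : Measurable fun x : ℕ => ∫⁻ u, H (Function.update t [] (x, u)) ∂lam :=
      measurable_of_countable _
    simp only [hroot]
    rw [lintegral_prod (fun e => H (Function.update t [] e))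
        (hH.comp (measurable_update t)).aemeasurable,
      ← lintegral_map hm measurable_fst, ← Measure.fst, Measure.fst_prod]
  rw [← lintegral_lintegral_swap hset.aemeasurable, treeLaw, lintegral_infinitePi_update _ [] hH,
    lintegral_infinitePi_update _ [] hset.lintegral_prod_right']
  exact lintegral_congr hresample

end Law

/-! ### The percolation threshold has no atoms -/

section Threshold

/-- The uniform distribution on `[0, 1]`, as a measure on the extended non-negative reals. -/
noncomputable def unifLaw : Measure ℝ≥0∞ :=
  (volume.restrict (Set.Icc (0 : ℝ) 1)).map ENNReal.ofReal

instance : IsProbabilityMeasure unifLaw := by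
  have : IsProbabilityMeasure (volume.restrict (Set.Icc (0 : ℝ) 1)) := ⟨by simp⟩
  exact Measure.isProbabilityMeasure_map ENNReal.measurable_ofReal.aemeasurable

lemma unifLaw_singleton (z : ℝ≥0∞) : unifLaw {z} = 0 := by
  rw [unifLaw, Measure.map_apply ENNReal.measurable_ofReal (measurableSet_singleton z),
    Measure.restrict_apply (ENNReal.measurable_ofReal (measurableSet_singleton z))]
  refine measure_mono_null (t := {z.toReal}) ?_ (by simp)
  rintro x ⟨hx, h0, -⟩
  rw [Set.mem_preimage, Set.mem_singleton_iff] at hx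
  rw [Set.mem_singleton_iff, ← hx, ENNReal.toReal_ofReal h0]

lemma unifLaw_Iic {p : ℝ} (h0 : 0 ≤ p) (h1 : p ≤ 1) :
    unifLaw (Set.Iic (ENNReal.ofReal p)) = ENNReal.ofReal p := by
  rw [unifLaw, Measure.map_apply ENNReal.measurable_ofReal measurableSet_Iic,
    Measure.restrict_apply (ENNReal.measurable_ofReal measurableSet_Iic)]
  have hIcc : ENNReal.ofReal ⁻¹' Set.Iic (ENNReal.ofReal p) ∩ Set.Icc 0 1 = Set.Icc 0 p := by
    ext x
    simp only [Set.mem_inter_iff, Set.mem_preimage, Set.mem_Iic, Set.mem_Icc,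
      ENNReal.ofReal_le_ofReal_iff h0]
    exact ⟨fun h => ⟨h.2.1, h.1⟩, fun h => ⟨h.2, h.1, h.2.trans h1⟩⟩
  rw [hIcc, Real.volume_Icc, sub_zero]

lemma ae_unifLaw_le_one : ∀ᵐ u ∂unifLaw, u ≤ 1 := by
  rw [unifLaw, ae_map_iff ENNReal.measurable_ofReal.aemeasurable measurableSet_Iic]
  filter_upwards [ae_restrict_mem measurableSet_Icc] with x hx
  exact ENNReal.ofReal_le_one.2 hx.2

/-- The probability that at least one of the children of a vertex is selected, when each is selected
independently with probability `s`. -/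
noncomputable def hitProb (ν : Measure ℕ) (s : ℝ) : ℝ := 1 - ∫ x, (1 - s) ^ x ∂ν

variable (ν : Measure ℕ) [IsProbabilityMeasure ν]

lemma integrable_one_sub_pow {s : ℝ} (h0 : 0 ≤ s) (h1 : s ≤ 1) :
    Integrable (fun x : ℕ => (1 - s) ^ x) ν := by
  refine Integrable.of_bound (measurable_of_countable _).aestronglyMeasurable 1 (ae_of_all _ ?_)
  intro x
  rw [Real.norm_of_nonneg (pow_nonneg (by linarith) _)]
  exact pow_le_one₀ (by linarith) (by linarith)

lemma continuousOn_hitProb : ContinuousOn (hitProb ν) (Set.Icc 0 1) := by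
  refine continuousOn_const.sub (continuousOn_of_dominated (bound := fun _ => 1) ?_ ?_ ?_ ?_)
  · exact fun s _ => (measurable_of_countable _).aestronglyMeasurable
  · intro s hs
    refine ae_of_all _ fun x => ?_
    rw [Real.norm_of_nonneg (pow_nonneg (by linarith [hs.2]) _)]
    exact pow_le_one₀ (by linarith [hs.2]) (by linarith [hs.1])
  · exact integrable_const _
  · exact ae_of_all _ fun x => by fun_prop

lemma hitProb_mono {s t : ℝ} (h0 : 0 ≤ s) (hst : s ≤ t) (h1 : t ≤ 1) :
    hitProb ν s ≤ hitProb ν t := by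
  refine sub_le_sub_left (integral_mono (integrable_one_sub_pow ν (h0.trans hst) h1)
    (integrable_one_sub_pow ν h0 (hst.trans h1)) fun x => ?_) _
  exact pow_le_pow_left₀ (by linarith) (by linarith) _

lemma one_sub_mul_pow_lt {x : ℕ} (hx : 2 ≤ x) {s l : ℝ} (hs0 : 0 < s) (hs1 : s ≤ 1)
    (hl0 : 0 < l) (hl1 : l < 1) : (1 - l * s) ^ x < l * (1 - s) ^ x + (1 - l) := by
  have hconv := (strictConvexOn_pow hx).2 (x := 1 - s) (Set.mem_Ici.2 (by linarith))
    (y := (1 : ℝ)) (Set.mem_Ici.2 zero_le_one) (by linarith) hl0 (sub_pos.2 hl1)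
    (add_sub_cancel l 1)
  simp only [smul_eq_mul, one_pow, mul_one] at hconv
  rwa [show l * (1 - s) + (1 - l) = 1 - l * s by ring] at hconv

lemma one_sub_mul_pow_le (x : ℕ) {s l : ℝ} (hs0 : 0 < s) (hs1 : s ≤ 1) (hl0 : 0 < l)
    (hl1 : l < 1) : (1 - l * s) ^ x ≤ l * (1 - s) ^ x + (1 - l) := by
  match x with
  | 0 => linarith
  | 1 => linarith
  | x + 2 => exact (one_sub_mul_pow_lt (Nat.le_add_left 2 x) hs0 hs1 hl0 hl1).le

lemma mul_hitProb_lt (hν : ν {x | 2 ≤ x} ≠ 0) {s l : ℝ} (hs0 : 0 < s) (hs1 : s ≤ 1) (hl0 : 0 < l)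
    (hl1 : l < 1) : l * hitProb ν s < hitProb ν (l * s) := by
  have hs := integrable_one_sub_pow ν hs0.le hs1
  have hls := integrable_one_sub_pow ν (mul_nonneg hl0.le hs0.le) (mul_le_one₀ hl1.le hs0.le hs1)
  have hmix : Integrable (fun x : ℕ => l * (1 - s) ^ x + (1 - l)) ν :=
    (hs.const_mul l).add (integrable_const _)
  have hlt : ∫ x, (1 - l * s) ^ x ∂ν < ∫ x : ℕ, (l * (1 - s) ^ x + (1 - l)) ∂ν := by
    rw [← sub_pos, ← integral_sub hmix hls, integral_pos_iff_support_of_nonneg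
      (fun x => sub_nonneg.2 (one_sub_mul_pow_le x hs0 hs1 hl0 hl1)) (hmix.sub hls)]
    exact (pos_iff_ne_zero.2 hν).trans_le (measure_mono fun x hx =>
      (sub_pos.2 (one_sub_mul_pow_lt hx hs0 hs1 hl0 hl1)).ne')
  rw [integral_add (hs.const_mul l) (integrable_const _), integral_const_mul, integral_const,
    probReal_univ, one_smul] at hlt
  rw [hitProb, hitProb]
  linarith

lemma measurableSet_forall_lt_mem {A : Set WTree} (hA : MeasurableSet A) :
    MeasurableSet {q : (ℕ × ℝ≥0∞) × (ℕ → WTree) | ∀ i < q.1.1, q.2 i ∈ A} := by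
  have : {q : (ℕ × ℝ≥0∞) × (ℕ → WTree) | ∀ i < q.1.1, q.2 i ∈ A} =
      ⋂ i, {q | i < q.1.1}ᶜ ∪ {q | q.2 i ∈ A} := by
    ext q
    simp only [Set.mem_ofPred_eq, Set.mem_iInter, Set.mem_union, Set.mem_compl_iff, imp_iff_not_or]
  rw [this]
  exact .iInter fun i => (measurableSet_lt measurable_const (by fun_prop)).compl.union
    (hA.preimage ((measurable_pi_apply i).comp measurable_snd))

lemma measure_forall_subtree_mem (η : Measure (ℕ × ℝ≥0∞)) [IsProbabilityMeasure η] {A : Set WTree}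
    (hA : MeasurableSet A) : treeLaw η {t | ∀ i < (t []).1, subtree [i] t ∈ A} =
      ∫⁻ e, treeLaw η A ^ e.1 ∂η := by
  have hS := measurableSet_forall_lt_mem hA
  change treeLaw η ((fun t : WTree => (t [], fun i => subtree [i] t)) ⁻¹'
    {q : (ℕ × ℝ≥0∞) × (ℕ → WTree) | ∀ i < q.1.1, q.2 i ∈ A}) = _
  rw [← Measure.map_apply (by fun_prop) hS, map_root_subtrees, Measure.prod_apply hS]
  refine lintegral_congr fun e => ?_
  have hpi := Measure.infinitePi_pi (fun _ : ℕ => treeLaw η) (s := Finset.range e.1)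
    (t := fun _ => A) fun _ _ => hA
  rw [Finset.prod_const, Finset.card_range] at hpi
  rw [← hpi]
  congr 1
  ext ξ
  simp only [Set.mem_preimage, Set.mem_ofPred_eq, Set.mem_pi, Finset.mem_coe, Finset.mem_range]

/-- The law of the branching process tree with uniform weights. -/
noncomputable abbrev bpLaw (ν : Measure ℕ) : Measure WTree := treeLaw (ν.prod unifLaw)

lemma measureReal_exists_subtree_mem {A : Set WTree} (hA : MeasurableSet A) :
    (bpLaw ν).real {t | ∃ i < (t []).1, subtree [i] t ∈ A} = hitProb ν ((bpLaw ν).real A) := by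
  have hcompl : {t : WTree | ∃ i < (t []).1, subtree [i] t ∈ A} =
      {t | ∀ i < (t []).1, subtree [i] t ∈ Aᶜ}ᶜ := by
    ext t
    simp only [Set.mem_ofPred_eq, Set.mem_compl_iff, not_forall, not_not, exists_prop]
  have hm : MeasurableSet {t : WTree | ∀ i < (t []).1, subtree [i] t ∈ Aᶜ} :=
    (measurableSet_forall_lt_mem hA.compl).preimage
      (f := fun t : WTree => (t [], fun i => subtree [i] t)) (by fun_prop)
  rw [hcompl, probReal_compl_eq_one_sub hm, measureReal_def, measure_forall_subtree_mem _ hA.compl,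
    ← lintegral_map (f := fun x : ℕ => bpLaw ν Aᶜ ^ x) (measurable_of_countable _) measurable_fst,
    ← Measure.fst, Measure.fst_prod, ← integral_toReal (measurable_of_countable _).aemeasurable
      (ae_of_all _ fun x => ENNReal.pow_lt_top (measure_lt_top _ _)), hitProb]
  simp only [ENNReal.toReal_pow, ← measureReal_def, probReal_compl_eq_one_sub hA]

lemma measureReal_max_root_le {f : WTree → ℝ≥0∞} (hf : Measurable f)
    (hroot : ∀ t u, f (setRoot t u) = f t) {p : ℝ} (h0 : 0 ≤ p) (h1 : p ≤ 1) :
    (bpLaw ν).real {t | max (t []).2 (f t) ≤ ENNReal.ofReal p} =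
      p * (bpLaw ν).real {t | f t ≤ ENNReal.ofReal p} := by
  have hm : MeasurableSet {t | max (t []).2 (f t) ≤ ENNReal.ofReal p} :=
    measurableSet_le (by fun_prop) measurable_const
  have hl : MeasurableSet {t | f t ≤ ENNReal.ofReal p} :=
    measurableSet_le (by fun_prop) measurable_const
  have hsplit : ∀ (t : WTree) (u : ℝ≥0∞),
      Set.indicator {t | max (t []).2 (f t) ≤ ENNReal.ofReal p} (1 : WTree → ℝ≥0∞)
        (setRoot t u) = Set.indicator {t | f t ≤ ENNReal.ofReal p} (1 : WTree → ℝ≥0∞) t *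
          (Set.Iic (ENNReal.ofReal p)).indicator 1 u := by
    intro t u
    simp only [Set.indicator_apply, Set.mem_ofPred_eq, setRoot_nil, hroot, max_le_iff,
      Set.mem_Iic, Pi.one_apply]
    split_ifs <;> simp_all
  have hmeas : bpLaw ν {t | max (t []).2 (f t) ≤ ENNReal.ofReal p} =
      bpLaw ν {t | f t ≤ ENNReal.ofReal p} * ENNReal.ofReal p := by
    rw [← lintegral_indicator_one hm, lintegral_setRoot ν unifLaw (measurable_one.indicator hm)]
    simp only [hsplit]
    rw [lintegral_congr fun u => lintegral_mul_const _ (measurable_one.indicator hl),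
      lintegral_const_mul _ (measurable_one.indicator measurableSet_Iic),
      lintegral_indicator_one hl, lintegral_indicator_one measurableSet_Iic, unifLaw_Iic h0 h1]
  rw [measureReal_def, hmeas, ENNReal.toReal_mul, ENNReal.toReal_ofReal h0, mul_comm,
    measureReal_def]

lemma measureReal_inf_children_le {f : WTree → ℝ≥0∞} (hf : Measurable f)
    (hroot : ∀ t u, f (setRoot t u) = f t) {p : ℝ} (h0 : 0 ≤ p) (h1 : p ≤ 1) :
    (bpLaw ν).real {t | ((Finset.range (t []).1).inf fun i =>
        max (subtree [i] t []).2 (f (subtree [i] t))) ≤ ENNReal.ofReal p} =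
      hitProb ν (p * (bpLaw ν).real {t | f t ≤ ENNReal.ofReal p}) := by
  rw [← measureReal_max_root_le ν hf hroot h0 h1,
    ← measureReal_exists_subtree_mem ν (measurableSet_le (by fun_prop) measurable_const)]
  congr 1
  ext t
  simp only [Set.mem_ofPred_eq, Finset.inf_le_iff ENNReal.ofReal_lt_top, Finset.mem_range]

/-- The probability of a path of length `n` from the root with weights at most `p`. -/
noncomputable def pathProb (n : ℕ) (p : ℝ) : ℝ :=
  (bpLaw ν).real {t | level n t ≤ ENNReal.ofReal p}

/-- The probability of percolation at level `p`. -/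
noncomputable def percProb (p : ℝ) : ℝ := (bpLaw ν).real {t | threshold t ≤ ENNReal.ofReal p}

lemma pathProb_le_one (n : ℕ) (p : ℝ) : pathProb ν n p ≤ 1 := measureReal_le_one

lemma pathProb_zero (p : ℝ) : pathProb ν 0 p = 1 := by
  simp only [pathProb, level, zero_le, Set.ofPred_true, probReal_univ]

lemma pathProb_succ (n : ℕ) {p : ℝ} (h0 : 0 ≤ p) (h1 : p ≤ 1) :
    pathProb ν (n + 1) p = hitProb ν (p * pathProb ν n p) :=
  measureReal_inf_children_le ν (measurable_level n) (level_setRoot n) h0 h1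

lemma percProb_eq_hitProb {p : ℝ} (h0 : 0 ≤ p) (h1 : p ≤ 1) :
    percProb ν p = hitProb ν (p * percProb ν p) := by
  rw [percProb, ← measureReal_inf_children_le ν measurable_threshold threshold_setRoot h0 h1]
  congr 1
  ext t
  rw [Set.mem_ofPred_eq, threshold_eq_inf]
  rfl

lemma tendsto_pathProb (p : ℝ) :
    Tendsto (fun n => pathProb ν n p) atTop (nhds (percProb ν p)) := by
  have hInter : {t | threshold t ≤ ENNReal.ofReal p} =
      ⋂ n, {t | level n t ≤ ENNReal.ofReal p} := by
    ext t
    simp only [threshold, iSup_le_iff, Set.mem_ofPred_eq, Set.mem_iInter]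
  rw [percProb, hInter]
  exact (ENNReal.continuousAt_toReal (measure_ne_top _ _)).tendsto.comp
    (tendsto_measure_iInter_atTop
      (fun n => (measurableSet_le (by fun_prop) measurable_const).nullMeasurableSet)
      (fun m n hmn t ht => (monotone_level t hmn).trans ht) ⟨0, measure_ne_top _ _⟩)

lemma le_percProb {p r : ℝ} (h0 : 0 ≤ p) (h1 : p ≤ 1) (hr0 : 0 ≤ r) (hr1 : r ≤ 1)
    (hr : r ≤ hitProb ν (p * r)) : r ≤ percProb ν p := by
  refine ge_of_tendsto' (tendsto_pathProb ν p) fun n => ?_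
  induction n with
  | zero => rwa [pathProb_zero]
  | succ n ih =>
    rw [pathProb_succ ν n h0 h1]
    refine hr.trans (hitProb_mono ν (by positivity) (mul_le_mul_of_nonneg_left ih h0) ?_)
    exact mul_le_one₀ h1 (hr0.trans ih) (pathProb_le_one ν n p)

variable {ν}

lemma ae_offspring_pos (hν₀ : ν {0} = 0) : ∀ᵐ t ∂bpLaw ν, ∀ v, 1 ≤ (t v).1 := by
  refine ae_all_iff.2 fun v => ?_
  have h1 : ∀ᵐ x ∂ν, 1 ≤ x := by
    have : ∀ᵐ x ∂ν, x ∉ ({0} : Set ℕ) := measure_eq_zero_iff_ae_notMem.1 hν₀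
    filter_upwards [this] with x hx
    exact Nat.one_le_iff_ne_zero.2 hx
  have h2 : ∀ᵐ e ∂ν.prod unifLaw, 1 ≤ e.1 :=
    Measure.quasiMeasurePreserving_fst.ae h1
  exact (measurePreserving_eval_infinitePi (fun _ : List ℕ => ν.prod unifLaw) v
    ).quasiMeasurePreserving.ae h2

lemma ae_weight {p : ℝ≥0∞ → Prop} (h : ∀ᵐ u ∂unifLaw, p u) :
    ∀ᵐ t ∂bpLaw ν, ∀ v, p (t v).2 :=
  ae_all_iff.2 fun v => (measurePreserving_eval_infinitePi (fun _ : List ℕ => ν.prod unifLaw) v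
    ).quasiMeasurePreserving.ae (Measure.quasiMeasurePreserving_snd.ae h)

lemma level_le_one {t : WTree} (h1 : ∀ v, 1 ≤ (t v).1) (h2 : ∀ v, (t v).2 ≤ 1) (n : ℕ) :
    level n t ≤ 1 := by
  induction n generalizing t with
  | zero => exact zero_le
  | succ n ih =>
    refine (Finset.inf_le (Finset.mem_range.2 (h1 []))).trans (max_le (h2 _) (ih ?_ ?_))
    · exact fun v => h1 _
    · exact fun v => h2 _

lemma threshold_le_one {t : WTree} (h1 : ∀ v, 1 ≤ (t v).1) (h2 : ∀ v, (t v).2 ≤ 1) :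
    threshold t ≤ 1 :=
  iSup_le fun n => level_le_one h1 h2 n

lemma threshold_pos {t : WTree} (hpos : ∀ v, (t v).2 ≠ 0) : 0 < threshold t := by
  rw [threshold_eq_inf, Finset.lt_inf_iff ENNReal.zero_lt_top]
  exact fun i _ => lt_max_of_lt_left (pos_iff_ne_zero.2 (hpos _))

/-- By strict concavity every `r` below the percolation probability at `p` satisfies
`r < hitProb (p r)`, hence also `r < hitProb (q r)` for some `q < p`, and then `r` is a lower bound
for the percolation probability at `q`. -/
lemma percProb_le_measureReal_lt (hν₂ : ν {x | 2 ≤ x} ≠ 0) {p : ℝ} (hp : 0 < p) (hp1 : p ≤ 1) :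
    percProb ν p ≤ (bpLaw ν).real {t | threshold t < ENNReal.ofReal p} := by
  refine le_of_forall_lt_imp_le_of_dense fun r hr => ?_
  rcases le_or_gt r 0 with hr0 | hr0
  · exact hr0.trans measureReal_nonneg
  have hθ0 : 0 < percProb ν p := hr0.trans hr
  have hθ1 : percProb ν p ≤ 1 := measureReal_le_one
  have hr1 : r ≤ 1 := hr.le.trans hθ1
  have hlt : r < hitProb ν (p * r) := by
    have h := mul_hitProb_lt ν hν₂ (mul_pos hp hθ0) (mul_le_one₀ hp1 hθ0.le hθ1)
      (div_pos hr0 hθ0) ((div_lt_one hθ0).2 hr)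
    rwa [← percProb_eq_hitProb ν hp.le hp1, mul_left_comm, div_mul_cancel₀ _ hθ0.ne'] at h
  have hcont : ContinuousWithinAt (fun q => hitProb ν (q * r)) (Set.Ioo 0 p) p :=
    (continuousOn_hitProb ν _ ⟨by positivity, mul_le_one₀ hp1 hr0.le hr1⟩).comp
      (f := fun q => q * r) (by fun_prop) fun q hq =>
        ⟨mul_nonneg hq.1.le hr0.le, mul_le_one₀ (hq.2.le.trans hp1) hr0.le hr1⟩
  have : (nhdsWithin p (Set.Ioo 0 p)).NeBot := by
    rw [nhdsWithin_Ioo_eq_nhdsLT hp]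
    infer_instance
  obtain ⟨q, hrq, hq⟩ :=
    ((hcont.tendsto.eventually_const_lt hlt).and eventually_mem_nhdsWithin).exists
  calc r ≤ percProb ν q :=
        le_percProb ν hq.1.le (hq.2.le.trans hp1) hr0.le hr1 hrq.le
    _ ≤ (bpLaw ν).real {t | threshold t < ENNReal.ofReal p} := measureReal_mono fun t ht =>
        lt_of_le_of_lt ht (ENNReal.ofReal_lt_ofReal_iff hp |>.2 hq.2)

lemma threshold_noAtoms (hν₀ : ν {0} = 0) (hν₂ : ν {x | 2 ≤ x} ≠ 0) (z : ℝ≥0∞) :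
    bpLaw ν {t | threshold t = z} = 0 := by
  rcases eq_or_ne z 0 with rfl | hz0
  · refine measure_eq_zero_iff_ae_notMem.2 ?_
    filter_upwards [ae_weight (ν := ν) (p := fun u => u ≠ 0)
      (measure_eq_zero_iff_ae_notMem.1 (unifLaw_singleton 0))] with t ht h
    exact (threshold_pos ht).ne' h
  rcases lt_or_ge 1 z with hz1 | hz1
  · refine measure_eq_zero_iff_ae_notMem.2 ?_
    filter_upwards [ae_offspring_pos hν₀, ae_weight (ν := ν) ae_unifLaw_le_one] with t h1 h2 h
    exact (threshold_le_one h1 h2).not_gt (hz1.trans_eq h.symm)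
  have hz : z ≠ ∞ := ne_top_of_le_ne_top ENNReal.one_ne_top hz1
  obtain ⟨p, hp, rfl⟩ : ∃ p, 0 < p ∧ ENNReal.ofReal p = z :=
    ⟨z.toReal, ENNReal.toReal_pos hz0 hz, ENNReal.ofReal_toReal hz⟩
  have hsub : {t | threshold t < ENNReal.ofReal p} ⊆ {t | threshold t ≤ ENNReal.ofReal p} :=
    fun t ht => le_of_lt (a := threshold t) ht
  have hdiff : {t | threshold t = ENNReal.ofReal p} =
      {t | threshold t ≤ ENNReal.ofReal p} \ {t | threshold t < ENNReal.ofReal p} := by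
    ext t
    simp only [Set.mem_ofPred_eq, Set.mem_sdiff, not_lt, le_antisymm_iff]
  rw [hdiff, ← measureReal_eq_zero_iff, measureReal_sdiff hsub
    (measurableSet_lt (by fun_prop) measurable_const), sub_eq_zero]
  exact (percProb_le_measureReal_lt hν₂ hp (ENNReal.ofReal_le_one.1 hz1)).antisymm
    (measureReal_mono hsub)

lemma gate_noAtoms (hν₀ : ν {0} = 0) (hν₂ : ν {x | 2 ≤ x} ≠ 0) (z : ℝ≥0∞) :
    bpLaw ν {t | gate t = z} = 0 := by
  refine measure_mono_null (t := {t | (t []).2 = z} ∪ {t | threshold t = z}) (fun t ht => ?_)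
    (measure_union_null ?_ (threshold_noAtoms hν₀ hν₂ z))
  · rcases max_choice (t []).2 (threshold t) with h | h
    · exact .inl (h.symm.trans ht)
    · exact .inr (h.symm.trans ht)
  · have := ae_weight (ν := ν) (p := fun u => u ≠ z)
      (measure_eq_zero_iff_ae_notMem.1 (unifLaw_singleton z))
    refine measure_eq_zero_iff_ae_notMem.2 ?_
    filter_upwards [this] with t ht using ht []

lemma ae_exists_isBestChild (hν₀ : ν {0} = 0) (hν₂ : ν {x | 2 ≤ x} ≠ 0) :
    ∀ᵐ t ∂bpLaw ν, IsBestChild t (bestChild t) := by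
  have : ∀ᵐ t ∂bpLaw ν, ∀ i j, i ≠ j → gate (subtree [i] t) ≠ gate (subtree [j] t) := by
    refine ae_all_iff.2 fun i => ae_all_iff.2 fun j => ?_
    by_cases hij : i = j
    · exact ae_of_all _ fun _ h => absurd hij h
    · filter_upwards [ae_ne_of_noAtoms _ hij measurable_gate measurable_gate
        (gate_noAtoms hν₀ hν₂)] with t ht _ using ht
  filter_upwards [this, ae_offspring_pos hν₀] with t ht h1
  obtain ⟨i, hi, hmin⟩ := Finset.exists_min_image (Finset.range (t []).1)
    (fun i => gate (subtree [i] t)) ⟨0, Finset.mem_range.2 (h1 [])⟩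
  have hb : IsBestChild t i := ⟨Finset.mem_range.1 hi, fun j hj hji =>
    lt_of_le_of_ne (hmin j (Finset.mem_range.2 hj)) (ht i j hji.symm)⟩
  rwa [hb.bestChild_eq]

end Threshold

/-! ### The Markov structure along the backbone -/

section Markov

open Classical in
/-- For data `p` of the root and its subtrees: `f` of the forest hanging off the root on the event
that the `i`-th child is the best one, if that child has gate `z`. -/
noncomputable def nextDensityTerm (f : ℝ≥0∞ → ℝ≥0∞) (i : ℕ) (z : ℝ≥0∞)
    (p : (ℕ × ℝ≥0∞) × (ℕ → WTree)) : ℝ≥0∞ :=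
  if i < p.1.1 ∧ ∀ j < p.1.1, j ≠ i → z < gate (p.2 j) then f (hangingWeight z i p.1.1 p.2) else 0

/-- The density of the law of the subtree of the best child, weighted by `f` of the forest, with
respect to the law of the tree; it depends on the subtree only through its gate `z`. -/
noncomputable def nextDensity (ν : Measure ℕ) (f : ℝ≥0∞ → ℝ≥0∞) (z : ℝ≥0∞) : ℝ≥0∞ :=
  ∑' i, ∫⁻ p, nextDensityTerm f i z p
    ∂(ν.prod unifLaw).prod (Measure.infinitePi fun _ : ℕ => bpLaw ν)

lemma measurable_nextDensityTerm {f : ℝ≥0∞ → ℝ≥0∞} (hf : Measurable f) (i : ℕ) :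
    Measurable fun q : ℝ≥0∞ × (ℕ × ℝ≥0∞) × (ℕ → WTree) => nextDensityTerm f i q.1 q.2 := by
  classical
  exact Measurable.ite (measurableSet_forall_ne_lt_gate i)
    (hf.comp (measurable_hangingWeight.comp (f := fun q : ℝ≥0∞ × (ℕ × ℝ≥0∞) × (ℕ → WTree) =>
      (((q.1, i), q.2.1.1), q.2.2)) (by fun_prop))) measurable_const

lemma nextDensityTerm_update (f : ℝ≥0∞ → ℝ≥0∞) (i : ℕ) (z : ℝ≥0∞) (e : ℕ × ℝ≥0∞)
    (ξ : ℕ → WTree) (s : WTree) :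
    nextDensityTerm f i z (e, Function.update ξ i s) = nextDensityTerm f i z (e, ξ) := by
  have hweight : hangingWeight z i e.1 (Function.update ξ i s) = hangingWeight z i e.1 ξ :=
    Finset.sum_congr rfl fun j hj => by rw [Function.update_of_ne (Finset.ne_of_mem_erase hj)]
  have hgate : (∀ j < e.1, j ≠ i → z < gate (Function.update ξ i s j)) ↔
      ∀ j < e.1, j ≠ i → z < gate (ξ j) :=
    forall₃_congr fun j _ h => by rw [Function.update_of_ne h]
  simp only [nextDensityTerm, hweight, hgate]

lemma nextDensityTerm_gate_subtree (f : ℝ≥0∞ → ℝ≥0∞) {t : WTree} {i : ℕ} (h : IsBestChild t i) :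
    nextDensityTerm f i (gate (subtree [i] t)) (t [], fun j => subtree [j] t) = f (forest t) :=
  (if_pos h).trans (by rw [forest, h.threshold_eq, h.bestChild_eq])

lemma nextDensityTerm_gate_subtree_eq_zero (f : ℝ≥0∞ → ℝ≥0∞) {t : WTree} {i : ℕ}
    (h : ¬ IsBestChild t i) :
    nextDensityTerm f i (gate (subtree [i] t)) (t [], fun j => subtree [j] t) = 0 :=
  if_neg h

variable {ν : Measure ℕ} [IsProbabilityMeasure ν]

lemma measurable_lintegral_nextDensityTerm {f : ℝ≥0∞ → ℝ≥0∞} (hf : Measurable f) (i : ℕ) :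
    Measurable fun z => ∫⁻ p, nextDensityTerm f i z p
      ∂(ν.prod unifLaw).prod (Measure.infinitePi fun _ : ℕ => bpLaw ν) :=
  (measurable_nextDensityTerm hf i).lintegral_prod_right'

lemma measurable_nextDensity {f : ℝ≥0∞ → ℝ≥0∞} (hf : Measurable f) :
    Measurable (nextDensity ν f) :=
  Measurable.tsum fun i => measurable_lintegral_nextDensityTerm hf i

/-- The subtree of the `i`-th child may be resampled, since the weight of the forest and the
comparison with the other children involve it only through its gate. -/
lemma lintegral_nextDensityTerm {f : ℝ≥0∞ → ℝ≥0∞} (hf : Measurable f) {H : WTree → ℝ≥0∞}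
    (hH : Measurable H) (i : ℕ) :
    ∫⁻ t, nextDensityTerm f i (gate (subtree [i] t)) (t [], fun j => subtree [j] t) *
        H (subtree [i] t) ∂bpLaw ν =
      ∫⁻ s, (∫⁻ p, nextDensityTerm f i (gate s) p
        ∂(ν.prod unifLaw).prod (Measure.infinitePi fun _ : ℕ => bpLaw ν)) * H s ∂bpLaw ν := by
  set ρ := Measure.infinitePi fun _ : ℕ => bpLaw ν
  have hterm : Measurable fun q : ((ℕ × ℝ≥0∞) × (ℕ → WTree)) × WTree =>
      nextDensityTerm f i (gate q.2) q.1 :=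
    (measurable_nextDensityTerm hf i).comp
      (f := fun q : ((ℕ × ℝ≥0∞) × (ℕ → WTree)) × WTree => (gate q.2, q.1)) (by fun_prop)
  have hmul : Measurable fun q : ((ℕ × ℝ≥0∞) × (ℕ → WTree)) × WTree =>
      nextDensityTerm f i (gate q.2) q.1 * H q.2 := hterm.mul (hH.comp measurable_snd)
  have hchild : Measurable fun p : (ℕ × ℝ≥0∞) × (ℕ → WTree) =>
      nextDensityTerm f i (gate (p.2 i)) p * H (p.2 i) :=
    hmul.comp (f := fun p : (ℕ × ℝ≥0∞) × (ℕ → WTree) => (p, p.2 i)) (by fun_prop)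
  have hresample : ∀ e : ℕ × ℝ≥0∞,
      ∫⁻ ξ, nextDensityTerm f i (gate (ξ i)) (e, ξ) * H (ξ i) ∂ρ =
        ∫⁻ ξ, ∫⁻ s, nextDensityTerm f i (gate s) (e, ξ) * H s ∂bpLaw ν ∂ρ := fun e => by
    have hchild_e : Measurable fun ξ : ℕ → WTree =>
        nextDensityTerm f i (gate (ξ i)) (e, ξ) * H (ξ i) := hchild.comp measurable_prodMk_left
    rw [lintegral_infinitePi_update (fun _ : ℕ => bpLaw ν) i hchild_e]
    simp only [nextDensityTerm_update, Function.update_self, ρ]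
  calc ∫⁻ t, nextDensityTerm f i (gate (subtree [i] t)) (t [], fun j => subtree [j] t) *
        H (subtree [i] t) ∂bpLaw ν
      = ∫⁻ p, nextDensityTerm f i (gate (p.2 i)) p * H (p.2 i) ∂(ν.prod unifLaw).prod ρ :=
        lintegral_root_subtrees (ν.prod unifLaw) hchild
    _ = ∫⁻ p, ∫⁻ s, nextDensityTerm f i (gate s) p * H s ∂bpLaw ν ∂(ν.prod unifLaw).prod ρ := by
        rw [lintegral_prod _ hchild.aemeasurable,
          lintegral_prod _ hmul.lintegral_prod_right'.aemeasurable]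
        exact lintegral_congr hresample
    _ = ∫⁻ s, ∫⁻ p, nextDensityTerm f i (gate s) p * H s ∂(ν.prod unifLaw).prod ρ ∂bpLaw ν :=
        lintegral_lintegral_swap hmul.aemeasurable
    _ = _ := lintegral_congr fun s =>
        lintegral_mul_const _ (hterm.comp (measurable_prodMk_right (y := s)))

lemma lintegral_forest_next (hν₀ : ν {0} = 0) (hν₂ : ν {x | 2 ≤ x} ≠ 0) {f : ℝ≥0∞ → ℝ≥0∞}
    (hf : Measurable f) {H : WTree → ℝ≥0∞} (hH : Measurable H) :
    ∫⁻ t, f (forest t) * H (next t) ∂bpLaw ν =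
      ∫⁻ s, nextDensity ν f (gate s) * H s ∂bpLaw ν := by
  have hsum : ∀ᵐ t ∂bpLaw ν, f (forest t) * H (next t) =
      ∑' i, nextDensityTerm f i (gate (subtree [i] t)) (t [], fun j => subtree [j] t) *
        H (subtree [i] t) := by
    filter_upwards [ae_exists_isBestChild hν₀ hν₂] with t ht
    rw [tsum_eq_single (bestChild t), nextDensityTerm_gate_subtree f ht, next]
    intro i hi
    rw [nextDensityTerm_gate_subtree_eq_zero f fun h => hi h.bestChild_eq.symm, zero_mul]
  have hterm : ∀ i, Measurable fun t : WTree => nextDensityTerm f i (gate (subtree [i] t))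
      (t [], fun j => subtree [j] t) * H (subtree [i] t) := fun i =>
    ((measurable_nextDensityTerm hf i).comp (f := fun t : WTree =>
      (gate (subtree [i] t), t [], fun j => subtree [j] t)) (by fun_prop)).mul
      (hH.comp (measurable_subtree [i]))
  rw [lintegral_congr_ae hsum, lintegral_tsum fun i => (hterm i).aemeasurable]
  simp only [lintegral_nextDensityTerm hf hH, nextDensity, ← ENNReal.tsum_mul_right]
  exact (lintegral_tsum fun i =>
    (((measurable_lintegral_nextDensityTerm hf i).comp measurable_gate).mul hH).aemeasurable).symm

lemma ae_gate_next (hν₀ : ν {0} = 0) (hν₂ : ν {x | 2 ≤ x} ≠ 0) :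
    ∀ᵐ t ∂bpLaw ν, gate (next t) = threshold t := by
  filter_upwards [ae_exists_isBestChild hν₀ hν₂] with t ht using ht.threshold_eq.symm

end Markov

section Marks

/-- The weight of the edge to the parent of the root and the weight of the forest at the root. -/
noncomputable def mark (t : WTree) : ℝ≥0∞ × ℝ≥0∞ := ((t []).2, forest t)

/-- The gates along the path of successive best children. -/
noncomputable def gates (t : WTree) (k : ℕ) : ℝ≥0∞ := gate (next^[k] t)

/-- The sequence `z, Z 0, Z 1, …`. -/
def consSeq (z : ℝ≥0∞) (Z : ℕ → ℝ≥0∞) : ℕ → ℝ≥0∞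
  | 0 => z
  | k + 1 => Z k

lemma gates_eq_consSeq (t : WTree) : gates t = consSeq (gate t) (gates (next t)) := by
  funext k
  cases k <;> rfl

@[fun_prop]
lemma measurable_mark : Measurable mark := by unfold mark; fun_prop

@[fun_prop]
lemma measurable_gates : Measurable gates :=
  measurable_pi_iff.2 fun k => measurable_gate.comp (measurable_next.iterate k)

@[fun_prop]
lemma measurable_consSeq : Measurable fun p : ℝ≥0∞ × (ℕ → ℝ≥0∞) => consSeq p.1 p.2 := by
  refine measurable_pi_iff.2 fun k => ?_
  cases k
  · exact measurable_fst
  · exact (measurable_pi_apply _).comp measurable_snd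

variable (ν : Measure ℕ) [IsProbabilityMeasure ν]

/-- The conditional law of the forest weight given the threshold. -/
noncomputable def forestKernel : Kernel ℝ≥0∞ ℝ≥0∞ := condDistrib forest threshold (bpLaw ν)

/-- The conditional law of the mark given the gate and the threshold. -/
noncomputable def markKernel : Kernel (ℝ≥0∞ × ℝ≥0∞) (ℝ≥0∞ × ℝ≥0∞) :=
  condDistrib mark (fun t => (gate t, threshold t)) (bpLaw ν)

instance : IsMarkovKernel (forestKernel ν) := by unfold forestKernel; infer_instance

instance : IsMarkovKernel (markKernel ν) := by unfold markKernel; infer_instance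

/-- The conditional law of the tree given its gate. -/
noncomputable def gateKernel : Kernel ℝ≥0∞ WTree := condDistrib id gate (bpLaw ν)

instance : IsMarkovKernel (gateKernel ν) := by unfold gateKernel; infer_instance

variable {ν}

lemma measurable_prod_mark (n : ℕ) {h : ℕ → ℝ≥0∞ × ℝ≥0∞ → ℝ≥0∞} (hh : ∀ k, Measurable (h k)) :
    Measurable fun t => ∏ k ∈ Finset.range n, h k (mark (next^[k] t)) :=
  Finset.measurable_fun_prod _ fun k _ => by fun_prop

lemma measurable_prod_lintegral_markKernel (n : ℕ) {h : ℕ → ℝ≥0∞ × ℝ≥0∞ → ℝ≥0∞}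
    (hh : ∀ k, Measurable (h k)) :
    Measurable fun t => ∏ k ∈ Finset.range n,
      ∫⁻ x, h k x ∂markKernel ν (gates t k, gates t (k + 1)) :=
  Finset.measurable_fun_prod _ fun k _ => (hh k).lintegral_kernel.comp (by fun_prop)

lemma quasiMeasurePreserving_next :
    Measure.QuasiMeasurePreserving next (bpLaw ν) (bpLaw ν) := by
  refine ⟨measurable_next, .mk fun s hs hs₀ => ?_⟩
  rw [Measure.map_apply measurable_next hs]
  refine measure_mono_null (t := ⋃ i, subtree [i] ⁻¹' s)
    (fun t ht => Set.mem_iUnion.2 ⟨bestChild t, ht⟩) (measure_iUnion_null fun i => ?_)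
  rwa [(measurePreserving_subtree (ν.prod unifLaw) [i]).measure_preimage hs.nullMeasurableSet]

lemma ae_iterate_next {p : WTree → Prop} (h : ∀ᵐ t ∂bpLaw ν, p t) :
    ∀ᵐ t ∂bpLaw ν, ∀ k, p (next^[k] t) :=
  ae_all_iff.2 fun k => (quasiMeasurePreserving_next.iterate k).ae h

/-- The thresholds along the path of successive best children. -/
noncomputable def thresholds (t : WTree) (k : ℕ) : ℝ := (threshold (next^[k] t)).toReal

/-- A statistic `f₀` of the forest at the root and a statistic `f` of the marks of the later
vertices along the path of successive best children. -/
noncomputable def markSeq (f₀ : ℝ≥0∞ → ℝ) (f : ℝ≥0∞ × ℝ≥0∞ → ℝ) (t : WTree) : ℕ → ℝ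
  | 0 => f₀ (forest t)
  | k + 1 => f (mark (next^[k + 1] t))

/-- The conditional law of the `i`-th term of `markSeq f₀ f` given that the thresholds are `z`. -/
noncomputable def markLaw (ν : Measure ℕ) [IsProbabilityMeasure ν] (f₀ : ℝ≥0∞ → ℝ)
    (f : ℝ≥0∞ × ℝ≥0∞ → ℝ) : ℕ → Set ℝ → (ℕ → ℝ) → ℝ≥0∞
  | 0, A, z => forestKernel ν (ENNReal.ofReal (z 0)) (f₀ ⁻¹' A)
  | k + 1, A, z =>
    markKernel ν (ENNReal.ofReal (z k), ENNReal.ofReal (z (k + 1))) (f ⁻¹' A)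

lemma measurable_thresholds : Measurable thresholds :=
  measurable_pi_iff.2 fun k =>
    (measurable_threshold.comp (measurable_next.iterate k)).ennreal_toReal

lemma measurable_markSeq {f₀ : ℝ≥0∞ → ℝ} (hf₀ : Measurable f₀) {f : ℝ≥0∞ × ℝ≥0∞ → ℝ}
    (hf : Measurable f) : Measurable (markSeq f₀ f) := by
  refine measurable_pi_iff.2 fun k => ?_
  cases k with
  | zero => exact hf₀.comp measurable_forest
  | succ k => exact hf.comp (measurable_mark.comp (measurable_next.iterate _))

lemma measurable_markLaw {f₀ : ℝ≥0∞ → ℝ} (hf₀ : Measurable f₀) {f : ℝ≥0∞ × ℝ≥0∞ → ℝ}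
    (hf : Measurable f) (i : ℕ) {A : Set ℝ} (hA : MeasurableSet A) :
    Measurable (markLaw ν f₀ f i A) := by
  cases i with
  | zero => exact ((forestKernel ν).measurable_coe (hf₀ hA)).comp (by fun_prop)
  | succ k =>
    have hz : Measurable fun z : ℕ → ℝ => (ENNReal.ofReal (z k), ENNReal.ofReal (z (k + 1))) := by
      fun_prop
    exact ((markKernel ν).measurable_coe (hf hA)).comp hz

lemma markLaw_univ (f₀ : ℝ≥0∞ → ℝ) (f : ℝ≥0∞ × ℝ≥0∞ → ℝ) (i : ℕ) (z : ℕ → ℝ) :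
    markLaw ν f₀ f i Set.univ z = 1 := by
  cases i <;> exact measure_univ

variable (hν₀ : ν {0} = 0) (hν₂ : ν {x | 2 ≤ x} ≠ 0)

include hν₀ hν₂

lemma lintegral_forest_threshold_next {a : ℝ≥0∞ → ℝ≥0∞} (ha : Measurable a)
    {b : ℝ≥0∞ × WTree → ℝ≥0∞} (hb : Measurable b) :
    ∫⁻ t, a (forest t) * b (threshold t, next t) ∂bpLaw ν =
      ∫⁻ s, nextDensity ν a (gate s) * b (gate s, s) ∂bpLaw ν := by
  rw [← lintegral_forest_next hν₀ hν₂ ha (H := fun s => b (gate s, s)) (by fun_prop)]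
  refine lintegral_congr_ae ?_
  filter_upwards [ae_gate_next hν₀ hν₂] with t ht
  rw [ht]

/-- The subtree of the best child has a density relative to the law of the tree that depends on its
gate only, so that given this gate it is distributed like the tree itself. -/
lemma lintegral_forest_gateKernel {a : ℝ≥0∞ → ℝ≥0∞} (ha : Measurable a)
    {b : ℝ≥0∞ × WTree → ℝ≥0∞} (hb : Measurable b) :
    ∫⁻ t, a (forest t) * b (threshold t, next t) ∂bpLaw ν =
      ∫⁻ t, a (forest t) * ∫⁻ s, b (threshold t, s) ∂gateKernel ν (threshold t) ∂bpLaw ν := by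
  have hD : Measurable (nextDensity ν a) := measurable_nextDensity ha
  have hmean : Measurable fun z => ∫⁻ s, b (z, s) ∂gateKernel ν z :=
    hb.lintegral_kernel_prod_right'
  rw [lintegral_forest_threshold_next hν₀ hν₂ ha hb,
    lintegral_forest_threshold_next hν₀ hν₂ ha
      (b := fun p => ∫⁻ s, b (p.1, s) ∂gateKernel ν p.1) (hmean.comp measurable_fst),
    ← lintegral_lintegral_condDistrib (A := fun s : WTree => s) measurable_id measurable_gate
      (g := fun p => nextDensity ν a p.1 * b p) (by fun_prop)]
  exact lintegral_congr fun s =>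
    lintegral_const_mul (nextDensity ν a (gate s)) (f := fun x => b (gate s, x)) (by fun_prop)

lemma lintegral_mark_gateKernel {a : ℝ≥0∞ × ℝ≥0∞ → ℝ≥0∞} (ha : Measurable a)
    {b : (ℝ≥0∞ × ℝ≥0∞) × WTree → ℝ≥0∞} (hb : Measurable b) :
    ∫⁻ t, a (mark t) * b ((gate t, threshold t), next t) ∂bpLaw ν =
      ∫⁻ t, a (mark t) * ∫⁻ s, b ((gate t, threshold t), s) ∂gateKernel ν (threshold t)
        ∂bpLaw ν := by
  have hmean : Measurable fun p : ℝ≥0∞ × ℝ≥0∞ => ∫⁻ s, b (p, s) ∂gateKernel ν p.2 :=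
    Measurable.lintegral_kernel_prod_right' (κ := (gateKernel ν).comap Prod.snd measurable_snd) hb
  have hmean_t : Measurable fun t => a (mark t) *
      ∫⁻ s, b ((gate t, threshold t), s) ∂gateKernel ν (threshold t) :=
    (ha.comp measurable_mark).mul
      (hmean.comp (f := fun t => (gate t, threshold t)) (by fun_prop))
  rw [lintegral_setRoot ν unifLaw (by fun_prop), lintegral_setRoot ν unifLaw hmean_t]
  refine lintegral_congr fun u => ?_
  simp only [mark, setRoot_nil, forest_setRoot, gate_setRoot, threshold_setRoot, next_setRoot]
  exact lintegral_forest_gateKernel hν₀ hν₂ (a := fun f => a (u, f)) (by fun_prop)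
    (b := fun p => b ((max u p.1, p.1), p.2)) (by fun_prop)

lemma lintegral_forest_mul_next {f : ℝ≥0∞ → ℝ≥0∞} (hf : Measurable f) {H : WTree → ℝ≥0∞}
    (hH : Measurable H) :
    ∫⁻ t, f (forest t) * H (next t) ∂bpLaw ν =
      ∫⁻ t, (∫⁻ x, f x ∂forestKernel ν (threshold t)) * H (next t) ∂bpLaw ν :=
  lintegral_mul_eq_of_kernel measurable_forest measurable_threshold (gateKernel ν)
    (fun _ ha _ hb => lintegral_forest_gateKernel hν₀ hν₂ ha hb) hf (hH.comp measurable_snd)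

lemma lintegral_mark_mul_gate_next {h : ℝ≥0∞ × ℝ≥0∞ → ℝ≥0∞} (hh : Measurable h)
    {H : ℝ≥0∞ × WTree → ℝ≥0∞} (hH : Measurable H) :
    ∫⁻ t, h (mark t) * H (gate t, next t) ∂bpLaw ν =
      ∫⁻ t, (∫⁻ x, h x ∂markKernel ν (gate t, threshold t)) * H (gate t, next t) ∂bpLaw ν :=
  lintegral_mul_eq_of_kernel (C := fun t => (gate t, threshold t)) measurable_mark (by fun_prop)
    ((gateKernel ν).comap Prod.snd measurable_snd)
    (fun _ ha _ hb => lintegral_mark_gateKernel hν₀ hν₂ ha hb) hh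
    (b := fun p => H (p.1.1, p.2)) (by fun_prop)

lemma lintegral_gate_next {H : ℝ≥0∞ × WTree → ℝ≥0∞} (hH : Measurable H) :
    ∫⁻ t, H (gate t, next t) ∂bpLaw ν =
      ∫⁻ u, ∫⁻ s, nextDensity ν (fun _ => 1) (gate s) * H (max u (gate s), s)
        ∂bpLaw ν ∂unifLaw := by
  rw [lintegral_setRoot ν unifLaw (by fun_prop)]
  refine lintegral_congr fun u => ?_
  simp only [gate_setRoot, next_setRoot]
  rw [← lintegral_forest_threshold_next hν₀ hν₂ measurable_const
    (b := fun p => H (max u p.1, p.2)) (by fun_prop)]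
  simp only [one_mul]

lemma lintegral_gates_next_mul_congr {Q R : WTree → ℝ≥0∞} (hQ : Measurable Q) (hR : Measurable R)
    (h : ∀ Φ : (ℕ → ℝ≥0∞) → ℝ≥0∞, Measurable Φ →
      ∫⁻ t, Φ (gates t) * Q t ∂bpLaw ν = ∫⁻ t, Φ (gates t) * R t ∂bpLaw ν)
    {Φ : ℝ≥0∞ × (ℕ → ℝ≥0∞) → ℝ≥0∞} (hΦ : Measurable Φ) :
    ∫⁻ t, Φ (gate t, gates (next t)) * Q (next t) ∂bpLaw ν =
      ∫⁻ t, Φ (gate t, gates (next t)) * R (next t) ∂bpLaw ν := by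
  have hone : Measurable (nextDensity ν fun _ => 1) := measurable_nextDensity measurable_const
  rw [lintegral_gate_next hν₀ hν₂ (H := fun p => Φ (p.1, gates p.2) * Q p.2) (by fun_prop),
    lintegral_gate_next hν₀ hν₂ (H := fun p => Φ (p.1, gates p.2) * R p.2) (by fun_prop)]
  refine lintegral_congr fun u => ?_
  simp only [← mul_assoc]
  exact h (fun Z => nextDensity ν (fun _ => 1) (Z 0) * Φ (max u (Z 0), Z)) (by fun_prop)

lemma lintegral_mark_mul_gates_next {h : ℝ≥0∞ × ℝ≥0∞ → ℝ≥0∞} (hh : Measurable h)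
    {Q R : WTree → ℝ≥0∞} (hQ : Measurable Q) (hR : Measurable R)
    (hQR : ∀ Φ : (ℕ → ℝ≥0∞) → ℝ≥0∞, Measurable Φ →
      ∫⁻ t, Φ (gates t) * Q t ∂bpLaw ν = ∫⁻ t, Φ (gates t) * R t ∂bpLaw ν)
    {Φ : ℝ≥0∞ × (ℕ → ℝ≥0∞) → ℝ≥0∞} (hΦ : Measurable Φ) :
    ∫⁻ t, h (mark t) * (Φ (gate t, gates (next t)) * Q (next t)) ∂bpLaw ν =
      ∫⁻ t, Φ (gate t, gates (next t)) * (∫⁻ x, h x ∂markKernel ν (gate t, gates (next t) 0)) *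
        R (next t) ∂bpLaw ν := by
  have hmean : Measurable fun p => ∫⁻ x, h x ∂markKernel ν p := hh.lintegral_kernel
  calc ∫⁻ t, h (mark t) * (Φ (gate t, gates (next t)) * Q (next t)) ∂bpLaw ν
      = ∫⁻ t, (∫⁻ x, h x ∂markKernel ν (gate t, threshold t)) *
          (Φ (gate t, gates (next t)) * Q (next t)) ∂bpLaw ν :=
        lintegral_mark_mul_gate_next hν₀ hν₂ hh (H := fun p => Φ (p.1, gates p.2) * Q p.2)
          (by fun_prop)
    _ = ∫⁻ t, Φ (gate t, gates (next t)) * (∫⁻ x, h x ∂markKernel ν (gate t, gates (next t) 0)) *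
          Q (next t) ∂bpLaw ν := by
        refine lintegral_congr_ae ?_
        filter_upwards [ae_gate_next hν₀ hν₂] with t ht
        rw [← ht, ← mul_assoc, mul_comm (∫⁻ x, h x ∂_)]
        rfl
    _ = _ := lintegral_gates_next_mul_congr hν₀ hν₂ hQ hR hQR
        (Φ := fun p => Φ p * ∫⁻ x, h x ∂markKernel ν (p.1, p.2 0))
        (hΦ.mul (hmean.comp (by fun_prop)))

lemma lintegral_forest_mul_gates_next {f : ℝ≥0∞ → ℝ≥0∞} (hf : Measurable f)
    {Q R : WTree → ℝ≥0∞} (hQ : Measurable Q) (hR : Measurable R)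
    (hQR : ∀ Φ : (ℕ → ℝ≥0∞) → ℝ≥0∞, Measurable Φ →
      ∫⁻ t, Φ (gates t) * Q t ∂bpLaw ν = ∫⁻ t, Φ (gates t) * R t ∂bpLaw ν)
    {Φ : (ℕ → ℝ≥0∞) → ℝ≥0∞} (hΦ : Measurable Φ) :
    ∫⁻ t, f (forest t) * (Φ (gates (next t)) * Q (next t)) ∂bpLaw ν =
      ∫⁻ t, Φ (gates (next t)) * (∫⁻ x, f x ∂forestKernel ν (gates (next t) 0)) *
        R (next t) ∂bpLaw ν := by
  have hmean : Measurable fun z => ∫⁻ x, f x ∂forestKernel ν z := hf.lintegral_kernel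
  calc ∫⁻ t, f (forest t) * (Φ (gates (next t)) * Q (next t)) ∂bpLaw ν
      = ∫⁻ t, (∫⁻ x, f x ∂forestKernel ν (threshold t)) *
          (Φ (gates (next t)) * Q (next t)) ∂bpLaw ν :=
        lintegral_forest_mul_next hν₀ hν₂ hf (H := fun s => Φ (gates s) * Q s) (by fun_prop)
    _ = ∫⁻ t, Φ (gates (next t)) * (∫⁻ x, f x ∂forestKernel ν (gates (next t) 0)) *
          Q (next t) ∂bpLaw ν := by
        refine lintegral_congr_ae ?_
        filter_upwards [ae_gate_next hν₀ hν₂] with t ht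
        rw [← ht, ← mul_assoc, mul_comm (∫⁻ x, f x ∂_)]
        rfl
    _ = _ := lintegral_gates_next_mul_congr hν₀ hν₂ hQ hR hQR
        (Φ := fun p => Φ p.2 * ∫⁻ x, f x ∂forestKernel ν (p.2 0))
        ((hΦ.comp measurable_snd).mul (hmean.comp (by fun_prop)))

lemma lintegral_prod_mark (n : ℕ) {h : ℕ → ℝ≥0∞ × ℝ≥0∞ → ℝ≥0∞} (hh : ∀ k, Measurable (h k))
    {Φ : (ℕ → ℝ≥0∞) → ℝ≥0∞} (hΦ : Measurable Φ) :
    ∫⁻ t, Φ (gates t) * ∏ k ∈ Finset.range n, h k (mark (next^[k] t)) ∂bpLaw ν =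
      ∫⁻ t, Φ (gates t) * ∏ k ∈ Finset.range n,
        ∫⁻ x, h k x ∂markKernel ν (gates t k, gates t (k + 1)) ∂bpLaw ν := by
  induction n generalizing h Φ with
  | zero => simp only [Finset.range_zero, Finset.prod_empty]
  | succ n ih =>
    calc ∫⁻ t, Φ (gates t) * ∏ k ∈ Finset.range (n + 1), h k (mark (next^[k] t)) ∂bpLaw ν
        = ∫⁻ t, h 0 (mark t) * (Φ (consSeq (gate t) (gates (next t))) *
            ∏ k ∈ Finset.range n, h (k + 1) (mark (next^[k] (next t)))) ∂bpLaw ν :=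
          lintegral_congr fun t => by
            rw [Finset.prod_range_succ', ← gates_eq_consSeq]
            simp only [Function.iterate_succ_apply, Function.iterate_zero_apply]
            ring
      _ = ∫⁻ t, Φ (consSeq (gate t) (gates (next t))) *
            (∫⁻ x, h 0 x ∂markKernel ν (gate t, gates (next t) 0)) *
            ∏ k ∈ Finset.range n, ∫⁻ x, h (k + 1) x
              ∂markKernel ν (gates (next t) k, gates (next t) (k + 1)) ∂bpLaw ν :=
          lintegral_mark_mul_gates_next hν₀ hν₂ (hh 0)
            (measurable_prod_mark n fun k => hh (k + 1))
            (measurable_prod_lintegral_markKernel n fun k => hh (k + 1))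
            (fun _ hΨ => ih (fun k => hh (k + 1)) hΨ) (hΦ.comp measurable_consSeq)
      _ = _ := lintegral_congr fun t => by
            rw [Finset.prod_range_succ', gates_eq_consSeq t]
            simp only [consSeq]
            ring

lemma lintegral_forest_mul_prod_mark (n : ℕ) {f : ℝ≥0∞ → ℝ≥0∞} (hf : Measurable f)
    {h : ℕ → ℝ≥0∞ × ℝ≥0∞ → ℝ≥0∞} (hh : ∀ k, Measurable (h k))
    {Φ : (ℕ → ℝ≥0∞) → ℝ≥0∞} (hΦ : Measurable Φ) :
    ∫⁻ t, Φ (gates (next t)) * (f (forest t) *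
        ∏ k ∈ Finset.range n, h k (mark (next^[k + 1] t))) ∂bpLaw ν =
      ∫⁻ t, Φ (gates (next t)) * ((∫⁻ x, f x ∂forestKernel ν (gates (next t) 0)) *
        ∏ k ∈ Finset.range n,
          ∫⁻ x, h k x ∂markKernel ν (gates (next t) k, gates (next t) (k + 1))) ∂bpLaw ν := by
  simp only [mul_left_comm (Φ _) (f _), Function.iterate_succ_apply,
    ← mul_assoc (Φ _) (∫⁻ x, f x ∂_)]
  exact lintegral_forest_mul_gates_next hν₀ hν₂ hf (measurable_prod_mark n hh)
    (measurable_prod_lintegral_markKernel n hh) (fun _ hΨ => lintegral_prod_mark hν₀ hν₂ n hh hΨ) hΦ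

lemma ae_gates_next_eq_thresholds :
    ∀ᵐ t ∂bpLaw ν, ∀ k, gates (next t) k = ENNReal.ofReal (thresholds t k) := by
  have hle : ∀ᵐ t ∂bpLaw ν, threshold t ≤ 1 := by
    filter_upwards [ae_offspring_pos hν₀, ae_weight (ν := ν) ae_unifLaw_le_one] with t ht ht'
    exact threshold_le_one ht ht'
  filter_upwards [ae_iterate_next (ae_gate_next hν₀ hν₂), ae_iterate_next hle] with t ht ht' k
  rw [thresholds, ENNReal.ofReal_toReal (ne_top_of_le_ne_top ENNReal.one_ne_top (ht' k)), ← ht k]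
  exact congrArg gate (Function.iterate_succ_apply' next k t)

lemma ae_toReal_gates_next_eq_thresholds :
    ∀ᵐ t ∂bpLaw ν, (fun k => (gates (next t) k).toReal) = thresholds t := by
  filter_upwards [ae_gates_next_eq_thresholds hν₀ hν₂] with t ht
  funext k
  rw [ht k]
  exact ENNReal.toReal_ofReal ENNReal.toReal_nonneg

lemma measure_thresholds_markSeq_range {f₀ : ℝ≥0∞ → ℝ} (hf₀ : Measurable f₀)
    {f : ℝ≥0∞ × ℝ≥0∞ → ℝ} (hf : Measurable f) (n : ℕ) {A : ℕ → Set ℝ}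
    (hA : ∀ i, MeasurableSet (A i)) {D : Set (ℕ → ℝ)} (hD : MeasurableSet D) :
    bpLaw ν (thresholds ⁻¹' D ∩ markSeq f₀ f ⁻¹' Set.pi (Finset.range (n + 1)) A) =
      ∫⁻ t in thresholds ⁻¹' D, ∏ i ∈ Finset.range (n + 1),
        markLaw ν f₀ f i (A i) (thresholds t) ∂bpLaw ν := by
  have hD' : MeasurableSet (thresholds ⁻¹' D) := measurable_thresholds hD
  have hAn : MeasurableSet (markSeq f₀ f ⁻¹' Set.pi (Finset.range (n + 1)) A) :=
    measurable_markSeq hf₀ hf (.pi (Finset.countable_toSet _) fun i _ => hA i)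
  set Φ : (ℕ → ℝ≥0∞) → ℝ≥0∞ := fun g => D.indicator 1 fun k => (g k).toReal
  have hΦ : Measurable Φ := (measurable_one.indicator hD).comp (by fun_prop)
  calc bpLaw ν (thresholds ⁻¹' D ∩ markSeq f₀ f ⁻¹' Set.pi (Finset.range (n + 1)) A)
      = ∫⁻ t, D.indicator 1 (thresholds t) *
          (Set.pi (Finset.range (n + 1)) A).indicator 1 (markSeq f₀ f t) ∂bpLaw ν := by
        rw [← lintegral_indicator_one (hD'.inter hAn), Set.inter_indicator_one]
        rfl
    _ = ∫⁻ t, Φ (gates (next t)) * ((f₀ ⁻¹' A 0).indicator 1 (forest t) *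
          ∏ k ∈ Finset.range n, (f ⁻¹' A (k + 1)).indicator 1 (mark (next^[k + 1] t)))
            ∂bpLaw ν := by
        refine lintegral_congr_ae ?_
        filter_upwards [ae_toReal_gates_next_eq_thresholds hν₀ hν₂] with t ht
        rw [Set.indicator_pi_one_apply, Finset.prod_range_succ', ← ht]
        exact congrArg (Φ (gates (next t)) * ·) (mul_comm _ _)
    _ = ∫⁻ t, Φ (gates (next t)) * (forestKernel ν (gates (next t) 0) (f₀ ⁻¹' A 0) *
          ∏ k ∈ Finset.range n, markKernel ν (gates (next t) k, gates (next t) (k + 1))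
            (f ⁻¹' A (k + 1))) ∂bpLaw ν := by
        rw [lintegral_forest_mul_prod_mark hν₀ hν₂ n (measurable_one.indicator (hf₀ (hA 0)))
          (fun k => measurable_one.indicator (hf (hA (k + 1)))) hΦ]
        simp only [lintegral_indicator_one (hf₀ (hA 0)), lintegral_indicator_one (hf (hA _))]
    _ = ∫⁻ t, (thresholds ⁻¹' D).indicator (fun t => ∏ i ∈ Finset.range (n + 1),
          markLaw ν f₀ f i (A i) (thresholds t)) t ∂bpLaw ν := by
        refine lintegral_congr_ae ?_
        filter_upwards [ae_toReal_gates_next_eq_thresholds hν₀ hν₂,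
          ae_gates_next_eq_thresholds hν₀ hν₂] with t ht ht'
        rw [show Φ (gates (next t)) = D.indicator 1 (thresholds t) from congrArg (D.indicator 1) ht]
        simp only [ht', Finset.prod_range_succ', mul_comm (∏ _ ∈ Finset.range n, _), markLaw]
        by_cases hz : thresholds t ∈ D <;> simp [hz]
    _ = _ := lintegral_indicator hD' _

/-- Conditionally on the thresholds along the path of successive best children, the marks along this
path are independent. -/
theorem condIndepGiven_markSeq_thresholds {f₀ : ℝ≥0∞ → ℝ} (hf₀ : Measurable f₀)
    {f : ℝ≥0∞ × ℝ≥0∞ → ℝ} (hf : Measurable f) :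
    CondIndepGiven (bpLaw ν) (markSeq f₀ f) thresholds := by
  classical
  refine ⟨(measurable_markSeq hf₀ hf).aemeasurable, measurable_thresholds.aemeasurable, ?_⟩
  refine ae_iIndepFun_condDistrib (φ := markLaw ν f₀ f) (measurable_markSeq hf₀ hf)
    measurable_thresholds (fun i _ => measurable_markLaw hf₀ hf i) fun S A hA D hD => ?_
  obtain ⟨n, hn⟩ : ∃ n, S ⊆ Finset.range (n + 1) :=
    ⟨S.sup id, fun i hi => Finset.mem_range_succ_iff.2 (Finset.le_sup (f := id) hi)⟩
  let A' : ℕ → Set ℝ := fun i => if i ∈ S then A i else Set.univ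
  have hA' : ∀ i, MeasurableSet (A' i) := fun i => by
    by_cases hi : i ∈ S <;> simp only [A', hi, if_true, if_false, hA, MeasurableSet.univ]
  have hbox : Set.pi S A = Set.pi (Finset.range (n + 1)) A' := by
    ext y
    refine forall_congr' fun i => ?_
    by_cases hi : i ∈ S
    · simp only [A', hi, Finset.mem_coe, hn hi, if_true]
    · simp only [A', hi, Finset.mem_coe, if_false, Set.mem_univ, implies_true, false_imp_iff]
  rw [hbox, measure_thresholds_markSeq_range hν₀ hν₂ hf₀ hf n hA' hD]
  refine lintegral_congr fun t => ?_
  rw [← Finset.prod_subset hn fun i _ hi => by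
    simp only [A', hi, if_false, markLaw_univ]]
  exact Finset.prod_congr rfl fun i hi => by simp only [A', hi, if_true]

end Marks

/-! ### Invasion percolation on a fixed tree -/

section Rays

/-- An infinite path of the Ulam–Harris tree that goes from parents to children. -/
def IsRay (b : ℕ → List ℕ) : Prop := ∀ k, ∃ i : ℕ, b (k + 1) = i :: b k

/-- A ray that uses vertices of the tree with offspring numbers `X` only, provided that its starting
point is such a vertex. -/
def IsRayIn (X : List ℕ → ℕ) (b : ℕ → List ℕ) : Prop := ∀ k, ∃ i < X (b k), b (k + 1) = i :: b k

variable {b : ℕ → List ℕ}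

lemma IsRayIn.isRay {X : List ℕ → ℕ} (hb : IsRayIn X b) : IsRay b :=
  fun k => (hb k).imp fun _ h => h.2

lemma IsRay.length (hb : IsRay b) (k : ℕ) : (b k).length = (b 0).length + k := by
  induction k with
  | zero => rfl
  | succ k ih =>
    obtain ⟨i, hi⟩ := hb k
    rw [hi, List.length_cons, ih, add_assoc]

lemma IsRay.injective (hb : IsRay b) : Function.Injective b := fun k m hkm => by
  have hlength := congrArg List.length hkm
  rw [hb.length, hb.length m] at hlength
  omega

lemma IsRay.suffix_iff (hb : IsRay b) {k m : ℕ} : b k <:+ b m ↔ k ≤ m := by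
  refine ⟨fun h => ?_, fun hkm => ?_⟩
  · have hlength := h.length_le
    rw [hb.length, hb.length m] at hlength
    omega
  · induction m, hkm using Nat.le_induction with
    | base => exact List.suffix_refl _
    | succ m _ ih =>
      obtain ⟨i, hi⟩ := hb m
      exact hi ▸ ih.trans (List.suffix_cons _ _)

lemma IsRay.exists_mem_notMem_succ (hb : IsRay b) {S : Set (List ℕ)} (hS : S.Finite)
    (h₀ : b 0 ∈ S) : ∃ m, b m ∈ S ∧ b (m + 1) ∉ S := by
  by_contra! h
  have hmem : ∀ m, b m ∈ S := fun m => by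
    induction m with
    | zero => exact h₀
    | succ m ih => exact h m ih
  exact Set.infinite_of_injective_forall_mem hb.injective hmem hS

lemma exists_cons_suffix {u v : List ℕ} (h : u <:+ v) (hne : u ≠ v) : ∃ i, i :: u <:+ v := by
  obtain ⟨s, rfl⟩ := h
  rcases List.eq_nil_or_concat s with rfl | ⟨s', i, rfl⟩
  · exact absurd rfl hne
  · exact ⟨i, s', by rw [List.concat_eq_append, List.append_assoc, List.singleton_append]⟩

/-- Kőnig's lemma. -/
lemma exists_isRay_of_infinite {X : List ℕ → ℕ} {C : Set (List ℕ)}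
    (hC : ∀ u ∈ C, ∀ v, v <:+ u → v ∈ C) (hX : ∀ i v, i :: v ∈ C → i < X v) (hinf : C.Infinite) :
    ∃ b, b 0 = [] ∧ IsRay b ∧ ∀ k, b k ∈ C := by
  have step : ∀ v : {v // {u ∈ C | v <:+ u}.Infinite},
      ∃ i : ℕ, {u ∈ C | i :: v.1 <:+ u}.Infinite := by
    rintro ⟨v, hv⟩
    by_contra! h
    refine hv (((Set.finite_singleton v).union
      ((Set.finite_Iio (X v)).biUnion fun i _ => h i)).subset ?_)
    rintro u ⟨hu, hvu⟩
    by_cases huv : v = u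
    · exact .inl huv.symm
    · obtain ⟨i, hi⟩ := exists_cons_suffix hvu huv
      exact .inr (Set.mem_biUnion (hX i v (hC u hu _ hi)) ⟨hu, hi⟩)
  choose i hi using step
  let b : ℕ → {v // {u ∈ C | v <:+ u}.Infinite} := fun k =>
    Nat.rec ⟨[], by simpa using hinf⟩ (fun _ v => ⟨i v :: v.1, hi v⟩) k
  refine ⟨fun k => (b k).1, rfl, fun k => ⟨i (b k), rfl⟩, fun k => ?_⟩
  obtain ⟨u, hu, hs⟩ := (b k).2.nonempty
  exact hC u hu _ hs

end Rays

section Invasion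

variable {X : List ℕ → ℕ} {w : List ℕ → ℝ}

lemma invasion_mono : Monotone (invasion X w) :=
  monotone_nat_of_le_succ fun _ => Set.subset_union_left

lemma mem_invasion_of_cons_mem {n i : ℕ} {v : List ℕ} (h : i :: v ∈ invasion X w n) :
    v ∈ invasion X w n := by
  induction n with
  | zero => exact absurd h (List.cons_ne_nil i v)
  | succ n ih =>
    rcases h with h | ⟨⟨-, -, u, hu, j, hj⟩, -⟩
    · exact .inl (ih h)
    · obtain ⟨-, rfl⟩ := List.cons.inj hj
      exact .inl hu

lemma mem_invasion_of_suffix {n : ℕ} {u v : List ℕ} (h : u ∈ invasion X w n) (hv : v <:+ u) :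
    v ∈ invasion X w n := by
  obtain ⟨s, rfl⟩ := hv
  induction s with
  | nil => exact h
  | cons i s ih => exact ih (mem_invasion_of_cons_mem h)

lemma inTree_of_mem_invasion {n : ℕ} {v : List ℕ} (h : v ∈ invasion X w n) : InTree X v := by
  induction n with
  | zero =>
    rw [Set.eq_of_mem_singleton h]
    trivial
  | succ n ih =>
    rcases h with h | h
    · exact ih h
    · exact h.1.1

lemma finite_boundary {S : Set (List ℕ)} (hS : S.Finite) : (boundary X S).Finite := by
  refine (hS.biUnion fun u _ => (Set.finite_Iio (X u)).image (· :: u)).subset ?_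
  rintro _ ⟨ht, -, u, hu, i, rfl⟩
  exact Set.mem_biUnion hu ⟨i, ht.2, rfl⟩

lemma finite_invasion (n : ℕ) : (invasion X w n).Finite := by
  induction n with
  | zero => exact Set.finite_singleton _
  | succ n ih => exact ih.union ((finite_boundary ih).subset fun _ h => h.1)

lemma nil_mem_invasion (n : ℕ) : [] ∈ invasion X w n :=
  invasion_mono (Nat.zero_le n) (Set.mem_singleton _)

lemma mem_cluster {v : List ℕ} : v ∈ cluster X w ↔ ∃ n, v ∈ invasion X w n := Set.mem_iUnion

lemma mem_cluster_of_suffix {u v : List ℕ} (h : u ∈ cluster X w) (hv : v <:+ u) :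
    v ∈ cluster X w := by
  obtain ⟨n, hn⟩ := mem_cluster.1 h
  exact mem_cluster.2 ⟨n, mem_invasion_of_suffix hn hv⟩

lemma inTree_of_mem_cluster {v : List ℕ} (h : v ∈ cluster X w) : InTree X v := by
  obtain ⟨n, hn⟩ := mem_cluster.1 h
  exact inTree_of_mem_invasion hn

lemma exists_mem_argminBoundary {v : List ℕ} (h : v ∈ cluster X w) (hv : v ≠ []) :
    ∃ n, v ∈ argminBoundary X w (invasion X w n) := by
  obtain ⟨n, hn⟩ := mem_cluster.1 h
  induction n with
  | zero => exact absurd hn hv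
  | succ n ih =>
    rcases hn with hn | hn
    · exact ih hn
    · exact ⟨n, hn⟩

lemma IsRayIn.exists_mem_boundary {b : ℕ → List ℕ} (hb : IsRayIn X b) {n : ℕ}
    (h₀ : b 0 ∈ invasion X w n) : ∃ m, b (m + 1) ∈ boundary X (invasion X w n) := by
  obtain ⟨m, hm, hm'⟩ := hb.isRay.exists_mem_notMem_succ (finite_invasion n) h₀
  obtain ⟨i, hi, hbi⟩ := hb m
  refine ⟨m, ?_, hm', b m, hm, i, hbi⟩
  rw [hbi]
  exact ⟨inTree_of_mem_invasion hm, hi⟩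

lemma IsRayIn.infinite_cluster {b : ℕ → List ℕ} (hb : IsRayIn X b) (h₀ : b 0 = []) :
    (cluster X w).Infinite := by
  intro hfin
  have hmem : ∀ v ∈ cluster X w, ∃ n, v ∈ invasion X w n := fun v hv => mem_cluster.1 hv
  choose! n hn using hmem
  obtain ⟨N, hN⟩ : ∃ N, cluster X w ⊆ invasion X w N :=
    ⟨hfin.toFinset.sup n, fun v hv =>
      invasion_mono (Finset.le_sup (f := n) (hfin.mem_toFinset.2 hv)) (hn v hv)⟩
  obtain ⟨m, hm⟩ := hb.exists_mem_boundary (h₀ ▸ nil_mem_invasion (w := w) N)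
  obtain ⟨v, hv, hmin⟩ := Set.exists_min_image _ w (finite_boundary (finite_invasion N)) ⟨_, hm⟩
  exact hv.2.1 (hN (mem_cluster.2 ⟨N + 1, .inr ⟨hv, hmin⟩⟩))

lemma exists_isRay_of_infinite_subset_cluster {C : Set (List ℕ)} (hsub : C ⊆ cluster X w)
    (hC : ∀ u ∈ C, ∀ v, v <:+ u → v ∈ C) (hinf : C.Infinite) :
    ∃ b, b 0 = [] ∧ IsRay b ∧ ∀ k, b k ∈ C :=
  exists_isRay_of_infinite hC (fun _ _ hv => (inTree_of_mem_cluster (hsub hv)).2) hinf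

end Invasion

section Paths

variable {t : WTree} {z : ℝ≥0∞}

lemma subtree_subtree (u v : List ℕ) (t : WTree) : subtree u (subtree v t) = subtree (u ++ v) t :=
  funext fun s => congrArg t (List.append_assoc s u v)

lemma PathBelow.mono {z' : ℝ≥0∞} (hz : z ≤ z') {s : List ℕ} (h : PathBelow z t s) :
    PathBelow z' t s := by
  induction s with
  | nil => exact le_trans h hz
  | cons i s ih => exact ⟨ih h.1, h.2.1, h.2.2.trans hz⟩

lemma PathBelow.exists_lt (hne : ∀ s, (t s).2 ≠ z) {s : List ℕ} (h : PathBelow z t s) :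
    ∃ z' < z, PathBelow z' t s := by
  induction s with
  | nil => exact ⟨_, h.lt_of_ne (hne _), le_rfl⟩
  | cons i s ih =>
    obtain ⟨z', hz', hs⟩ := ih h.1
    exact ⟨max z' (t (i :: s)).2, max_lt hz' (h.2.2.lt_of_ne (hne _)), hs.mono (le_max_left _ _),
      h.2.1, le_max_right _ _⟩

lemma IsRayIn.threshold_le {b : ℕ → List ℕ} (hb : IsRayIn (fun v => (t v).1) b)
    (hz : ∀ k, (t (b (k + 1))).2 ≤ z) : threshold (subtree (b 0) t) ≤ z := by
  refine iSup_le fun n => ?_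
  induction n generalizing b with
  | zero => exact zero_le
  | succ n ih =>
    obtain ⟨i, hi, hbi⟩ := hb 0
    refine (Finset.inf_le (Finset.mem_range.2 hi)).trans ?_
    rw [subtree_subtree, List.singleton_append, ← hbi]
    exact max_le (hz 0) (ih (b := fun k => b (k + 1)) (fun k => hb (k + 1)) fun k => hz (k + 1))

end Paths

section Generic

/-- The generic trees: every vertex has a child, the weights are at most one, at every vertex the
threshold is attained through a single child, and it differs from the weights of the edges in the
subtrees of the other children. -/
structure Generic (t : WTree) : Prop where
  one_le_offspring : ∀ v, 1 ≤ (t v).1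
  weight_le_one : ∀ v, (t v).2 ≤ 1
  isBestChild : ∀ v, IsBestChild (subtree v t) (bestChild (subtree v t))
  weight_ne_gate : ∀ v i j s, i ≠ j → (subtree (i :: v) t s).2 ≠ gate (subtree (j :: v) t)

lemma ae_generic {ν : Measure ℕ} [IsProbabilityMeasure ν] (hν₀ : ν {0} = 0)
    (hν₂ : ν {x | 2 ≤ x} ≠ 0) : ∀ᵐ t ∂bpLaw ν, Generic t := by
  have hereditary : ∀ {p : WTree → Prop}, (∀ᵐ t ∂bpLaw ν, p t) →
      ∀ᵐ t ∂bpLaw ν, ∀ v, p (subtree v t) := fun hp => ae_all_iff.2 fun v =>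
    (measurePreserving_subtree (ν.prod unifLaw) v).quasiMeasurePreserving.ae hp
  have hweight : ∀ s z, bpLaw ν {t | (t s).2 = z} = 0 := fun s z => by
    refine measure_eq_zero_iff_ae_notMem.2 ?_
    filter_upwards [ae_weight (ν := ν) (p := fun u => u ≠ z)
      (measure_eq_zero_iff_ae_notMem.1 (unifLaw_singleton z))] with t ht using ht s
  have hne : ∀ᵐ t ∂bpLaw ν, ∀ i j s, i ≠ j → (subtree [i] t s).2 ≠ gate (subtree [j] t) := by
    simp only [ae_all_iff]
    exact fun i j s hij => ae_ne_of_noAtoms (ν.prod unifLaw) hij (f := fun t => (t s).2)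
      (by fun_prop) measurable_gate (hweight s)
  filter_upwards [ae_offspring_pos hν₀, ae_weight (ν := ν) ae_unifLaw_le_one,
    hereditary (ae_exists_isBestChild hν₀ hν₂), hereditary hne] with t hpos hle hbest hne
  refine ⟨hpos, hle, hbest, fun v i j s hij => ?_⟩
  simpa only [subtree_subtree, List.singleton_append] using hne v i j s hij

/-- The path that follows the best children from `u`. -/
noncomputable def bestPath (t : WTree) (u : List ℕ) : ℕ → List ℕ
  | 0 => u
  | k + 1 => bestChild (subtree (bestPath t u k) t) :: bestPath t u k

lemma next_iterate (t : WTree) (k : ℕ) : next^[k] t = subtree (bestPath t [] k) t := by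
  induction k with
  | zero => exact funext fun u => congrArg t (List.append_nil u).symm
  | succ k ih =>
    rw [Function.iterate_succ_apply', ih, next, subtree_subtree, List.singleton_append, bestPath]

namespace Generic

variable {t : WTree} (h : Generic t) (u : List ℕ)

include h

lemma threshold_subtree_le_one : threshold (subtree u t) ≤ 1 :=
  threshold_le_one (fun _ => h.one_le_offspring _) fun _ => h.weight_le_one _

lemma isRayIn_bestPath : IsRayIn (fun v => (t v).1) (bestPath t u) :=
  fun _ => ⟨_, (h.isBestChild _).1, rfl⟩

lemma threshold_eq_gate :
    threshold (subtree u t) = gate (subtree (bestChild (subtree u t) :: u) t) := by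
  rw [(h.isBestChild u).threshold_eq, subtree_subtree, List.singleton_append]

lemma threshold_lt_gate {i : ℕ} (hi : i < (t u).1) (hne : i ≠ bestChild (subtree u t)) :
    threshold (subtree u t) < gate (subtree (i :: u) t) := by
  have hlt := (h.isBestChild u).2 i hi hne
  rwa [← (h.isBestChild u).threshold_eq, subtree_subtree, List.singleton_append] at hlt

lemma antitone_threshold_bestPath : Antitone fun k => threshold (subtree (bestPath t u k) t) :=
  antitone_nat_of_succ_le fun _ => (le_max_right _ _).trans_eq (h.threshold_eq_gate _).symm

lemma weight_bestPath_le {k m : ℕ} (hkm : k < m) :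
    (t (bestPath t u m)).2 ≤ threshold (subtree (bestPath t u k) t) := by
  obtain ⟨m, rfl⟩ := Nat.exists_eq_add_of_lt hkm
  exact ((le_max_left _ _).trans_eq (h.threshold_eq_gate _).symm).trans
    (h.antitone_threshold_bestPath u (Nat.le_add_right k m))

end Generic

end Generic

section Backbone

/-- The weighted tree with offspring numbers `X` and weights `w`. -/
noncomputable def toTree (X : List ℕ → ℕ) (w : List ℕ → ℝ) : WTree :=
  fun v => (X v, ENNReal.ofReal (w v))

variable {X : List ℕ → ℕ} {w : List ℕ → ℝ} (h : Generic (toTree X w))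

include h

/-- When an edge beyond `u` is invaded, the path of best children from `u` offers an edge with
weight at most the threshold of `u`. -/
lemma weight_le_threshold {u v : List ℕ} (hv : v ∈ cluster X w) (huv : u <:+ v) (hne : u ≠ v) :
    ENNReal.ofReal (w v) ≤ threshold (subtree u (toTree X w)) := by
  have hv₀ : v ≠ [] := by
    rintro rfl
    exact hne (List.suffix_nil.1 huv)
  obtain ⟨n, ⟨-, -, v', hv', i, rfl⟩, hmin⟩ := exists_mem_argminBoundary hv hv₀
  have hu : u ∈ invasion X w n :=
    mem_invasion_of_suffix hv' ((List.suffix_cons_iff.1 huv).resolve_left hne)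
  obtain ⟨m, hm⟩ := (h.isRayIn_bestPath u).exists_mem_boundary hu
  exact (ENNReal.ofReal_le_ofReal (hmin _ hm)).trans (h.weight_bestPath_le u (Nat.succ_pos m))

/-- A path in the cluster has its weights beyond any vertex bounded by the threshold of this vertex,
so it continues through the best child. -/
lemma isBackbone_eq_bestPath {b : ℕ → List ℕ} (hb : IsBackbone X w b) :
    b = bestPath (toTree X w) [] := by
  obtain ⟨h₀, hray, hmem⟩ := hb
  have hray : IsRay b := hray
  have hrayIn : IsRayIn X b := fun k => by
    obtain ⟨i, hi⟩ := hray k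
    have htree := inTree_of_mem_cluster (hmem (k + 1))
    rw [hi] at htree
    exact ⟨i, htree.2, hi⟩
  have hle : ∀ {k m}, k < m → ENNReal.ofReal (w (b m)) ≤ threshold (subtree (b k) (toTree X w)) :=
    fun hkm => weight_le_threshold h (hmem _) (hray.suffix_iff.2 hkm.le) (hray.injective.ne hkm.ne)
  funext k
  induction k with
  | zero => exact h₀
  | succ k ih =>
    obtain ⟨i, hi, hbi⟩ := hrayIn k
    rw [bestPath, ← ih, hbi, List.cons_eq_cons]
    refine ⟨?_, rfl⟩
    by_contra hne
    refine (h.threshold_lt_gate (b k) hi hne).not_ge ?_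
    rw [← hbi]
    exact max_le (hle k.lt_succ_self) (IsRayIn.threshold_le (b := fun j => b (k + 1 + j))
      (fun j => hrayIn (k + 1 + j)) fun j => hle (by omega))

lemma isBackbone_bestPath : IsBackbone X w (bestPath (toTree X w) []) := by
  obtain ⟨b, hb⟩ := exists_isRay_of_infinite_subset_cluster subset_rfl
    (fun _ hu _ hv => mem_cluster_of_suffix hu hv) ((h.isRayIn_bestPath []).infinite_cluster rfl)
  rwa [← isBackbone_eq_bestPath h hb]

lemma backbone_eq_bestPath : backbone X w = bestPath (toTree X w) [] := by
  have hex : ∃ b, IsBackbone X w b := ⟨_, isBackbone_bestPath h⟩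
  rw [backbone, dif_pos hex]
  exact isBackbone_eq_bestPath h hex.choose_spec

lemma existsUnique_isBackbone : ∃! b, IsBackbone X w b :=
  ⟨_, isBackbone_bestPath h, fun _ hb => isBackbone_eq_bestPath h hb⟩

lemma isBackbone_backbone : IsBackbone X w (backbone X w) :=
  backbone_eq_bestPath h ▸ isBackbone_bestPath h

lemma isRayIn_backbone : IsRayIn X (backbone X w) :=
  backbone_eq_bestPath h ▸ h.isRayIn_bestPath []

lemma backbone_succ (k : ℕ) : backbone X w (k + 1) =
    bestChild (subtree (backbone X w k) (toTree X w)) :: backbone X w k := by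
  rw [backbone_eq_bestPath h, bestPath]

lemma next_iterate_toTree (k : ℕ) :
    next^[k] (toTree X w) = subtree (backbone X w k) (toTree X w) := by
  rw [next_iterate, backbone_eq_bestPath h]

lemma backbone_suffix_iff {k m : ℕ} : backbone X w k <:+ backbone X w m ↔ k ≤ m :=
  (isRayIn_backbone h).isRay.suffix_iff

lemma finite_cut (k : ℕ) : (cut X w k).Finite := by
  by_contra hinf
  obtain ⟨b, h₀, hray, hmem⟩ := exists_isRay_of_infinite_subset_cluster (C := cut X w k)
    (fun _ hv => hv.1)
    (fun _ hu _ hv => ⟨mem_cluster_of_suffix hu.1 hv, fun hk => hu.2 (hk.trans hv)⟩) hinf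
  have hb : b = backbone X w := (isBackbone_eq_bestPath h ⟨h₀, hray, fun k => (hmem k).1⟩).trans
    (backbone_eq_bestPath h).symm
  exact (hmem (k + 1)).2 (hb ▸ List.suffix_refl _)

lemma futureMax_eq_thresholds (hw : ∀ v, 0 ≤ w v) :
    futureMax X w = thresholds (toTree X w) := by
  funext k
  rw [futureMax, thresholds, next_iterate_toTree h]
  have hfin : threshold (subtree (backbone X w k) (toTree X w)) ≠ ∞ :=
    ne_top_of_le_ne_top ENNReal.one_ne_top (h.threshold_subtree_le_one _)
  refine IsLUB.csSup_eq ⟨?_, fun p hp => ?_⟩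
    ⟨_, Set.mem_image_of_mem _ (Set.mem_Ioi.2 k.lt_succ_self)⟩
  · rintro _ ⟨i, hi, rfl⟩
    rw [backbone_eq_bestPath h] at hfin ⊢
    exact (ENNReal.ofReal_le_iff_le_toReal hfin).1 (h.weight_bestPath_le [] hi)
  · have hle : ∀ i, k < i → w (backbone X w i) ≤ p := fun i hi => hp ⟨i, hi, rfl⟩
    refine ENNReal.toReal_le_of_le_ofReal ((hw _).trans (hle (k + 1) k.lt_succ_self)) ?_
    exact IsRayIn.threshold_le (b := fun m => backbone X w (k + m))
      (fun m => isRayIn_backbone h (k + m))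
      fun m => ENNReal.ofReal_le_ofReal (hle _ (by omega))

end Backbone

section Hanging

variable {X : List ℕ → ℕ} {w : List ℕ → ℝ}

/-- From `u` on, the invasion fills clusters whose level is below every boundary weight. -/
lemma mem_invasion_of_pathBelow {n : ℕ} {z : ℝ≥0∞} {u : List ℕ} {j : ℕ} {s : List ℕ}
    (hmin : ∀ v ∈ boundary X (invasion X w n), z < ENNReal.ofReal (w v))
    (hu : u ∈ invasion X w n) (hj : j < X u)
    (hs : PathBelow z (subtree (j :: u) (toTree X w)) s) : s ++ j :: u ∈ invasion X w n := by
  have hchild : ∀ {v i}, v ∈ invasion X w n → i < X v → ENNReal.ofReal (w (i :: v)) ≤ z →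
      i :: v ∈ invasion X w n := fun {v i} hv hi hle => by
    by_contra hnot
    exact hle.not_gt (hmin _ ⟨⟨inTree_of_mem_invasion hv, hi⟩, hnot, v, hv, i, rfl⟩)
  induction s with
  | nil => exact hchild hu hj hs
  | cons i s ih => exact hchild (ih hs.1) hs.2.1 hs.2.2

lemma append_cons_ne (s : List ℕ) (j : ℕ) (u : List ℕ) : s ++ j :: u ≠ u := fun he => by
  have hlength := congrArg List.length he
  rw [List.length_append, List.length_cons] at hlength
  omega

lemma cons_suffix_append_cons_iff {i j : ℕ} {s u : List ℕ} : i :: u <:+ s ++ j :: u ↔ i = j := by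
  refine ⟨fun hs => ?_, fun hij => hij ▸ List.suffix_append _ _⟩
  have hsuffix := List.suffix_of_suffix_length_le hs (List.suffix_append s (j :: u)) le_rfl
  exact (List.cons.inj (hsuffix.eq_of_length rfl)).1

lemma append_cons_injective (u : List ℕ) :
    Function.Injective fun p : ℕ × List ℕ => p.2 ++ p.1 :: u := by
  rintro ⟨j, s⟩ ⟨j', s'⟩ (he : s ++ j :: u = s' ++ j' :: u)
  obtain rfl : j = j' := cons_suffix_append_cons_iff.1 (he ▸ List.suffix_append s (j :: u))
  exact congrArg (Prod.mk j) (List.append_cancel_right he)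

lemma summable_of_finite {S : Set (List ℕ)} (hS : S.Finite) : Summable fun v : S => w v :=
  have := hS.to_subtype
  .of_finite

variable (h : Generic (toTree X w))

include h

/-- The invasion takes an edge of weight above `z` beyond the `k`-th backbone vertex, and at that
time no boundary edge is lighter. -/
lemma exists_lt_weight_boundary (k : ℕ) {z : ℝ≥0∞}
    (hz : z < threshold (subtree (backbone X w k) (toTree X w))) :
    ∃ n, backbone X w k ∈ invasion X w n ∧
      ∀ v ∈ boundary X (invasion X w n), z < ENNReal.ofReal (w v) := by
  obtain ⟨m, hm⟩ : ∃ m, z < ENNReal.ofReal (w (backbone X w (k + m + 1))) := by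
    by_contra! hle
    exact hz.not_ge (IsRayIn.threshold_le (b := fun m => backbone X w (k + m))
      (fun m => isRayIn_backbone h (k + m)) hle)
  obtain ⟨n, ⟨-, -, v, hv, i, hi⟩, hmin⟩ :=
    exists_mem_argminBoundary ((isBackbone_backbone h).2.2 (k + m + 1))
      (backbone_succ h (k + m) ▸ List.cons_ne_nil _ _)
  rw [backbone_succ h] at hi
  obtain ⟨-, rfl⟩ := List.cons.inj hi
  exact ⟨n, mem_invasion_of_suffix hv ((backbone_suffix_iff h).2 (Nat.le_add_right k m)),
    fun v hv => hm.trans_le (ENNReal.ofReal_le_ofReal (hmin v hv))⟩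

lemma pathBelow_of_mem_cluster {u : List ℕ} {j : ℕ} {s : List ℕ}
    (hs : s ++ j :: u ∈ cluster X w) :
    PathBelow (threshold (subtree u (toTree X w))) (subtree (j :: u) (toTree X w)) s := by
  have hle : ∀ {s'}, s' ++ j :: u ∈ cluster X w →
      ENNReal.ofReal (w (s' ++ j :: u)) ≤ threshold (subtree u (toTree X w)) := fun {s'} hs' =>
    weight_le_threshold h hs' ((List.suffix_cons j u).trans (List.suffix_append s' _))
      (append_cons_ne s' j u).symm
  induction s with
  | nil => exact hle hs
  | cons i s ih =>
    exact ⟨ih (mem_cluster_of_suffix hs (List.suffix_cons i _)), (inTree_of_mem_cluster hs).2,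
      hle hs⟩

lemma mem_cluster_append_cons_iff {k j : ℕ} {s : List ℕ}
    (hj : j ≠ bestChild (subtree (backbone X w k) (toTree X w))) :
    s ++ j :: backbone X w k ∈ cluster X w ↔ j < X (backbone X w k) ∧
      PathBelow (threshold (subtree (backbone X w k) (toTree X w)))
        (subtree (j :: backbone X w k) (toTree X w)) s := by
  refine ⟨fun hs => ⟨(inTree_of_mem_cluster (mem_cluster_of_suffix hs
    (List.suffix_append s _))).2, pathBelow_of_mem_cluster h hs⟩, fun ⟨hjX, hs⟩ => ?_⟩
  obtain ⟨z, hz, hs⟩ := hs.exists_lt fun s' => by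
    rw [h.threshold_eq_gate]
    exact h.weight_ne_gate _ _ _ s' hj
  obtain ⟨n, hn, hmin⟩ := exists_lt_weight_boundary h k hz
  exact mem_cluster.2 ⟨n, mem_invasion_of_pathBelow hmin hn hjX hs⟩

lemma mem_attached_iff {k : ℕ} {v : List ℕ} : v ∈ attached X w k ↔
    v ∈ cluster X w ∧ backbone X w k <:+ v ∧ ¬ backbone X w (k + 1) <:+ v := by
  cases k with
  | zero => simp only [attached, cut, Set.mem_ofPred_eq, (isBackbone_backbone h).1,
      List.nil_suffix, true_and]
  | succ k =>
    simp only [attached, cut, Set.mem_sdiff, Set.mem_ofPred_eq]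
    tauto

lemma attached_ne_backbone_eq_image (k : ℕ) :
    {v | v ∈ attached X w k ∧ v ≠ backbone X w k} =
      (fun p : ℕ × List ℕ => p.2 ++ p.1 :: backbone X w k) ''
        {p | p.1 ∈ (Finset.range (X (backbone X w k))).erase
            (bestChild (subtree (backbone X w k) (toTree X w))) ∧
          PathBelow (threshold (subtree (backbone X w k) (toTree X w)))
            (subtree (p.1 :: backbone X w k) (toTree X w)) p.2} := by
  ext v
  simp only [Set.mem_ofPred_eq, Set.mem_image, mem_attached_iff h, Finset.mem_erase,
    Finset.mem_range, Prod.exists]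
  constructor
  · rintro ⟨⟨hv, hs, hns⟩, hne⟩
    obtain ⟨j, s, rfl⟩ := exists_cons_suffix hs hne.symm
    have hj := fun hj : j = _ =>
      hns ((backbone_succ h k).symm ▸ cons_suffix_append_cons_iff.2 hj.symm)
    obtain ⟨hjX, hpath⟩ := (mem_cluster_append_cons_iff h hj).1 hv
    exact ⟨j, s, ⟨⟨hj, hjX⟩, hpath⟩, rfl⟩
  · rintro ⟨j, s, ⟨⟨hj, hjX⟩, hpath⟩, rfl⟩
    refine ⟨⟨(mem_cluster_append_cons_iff h hj).2 ⟨hjX, hpath⟩,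
      (List.suffix_cons j _).trans (List.suffix_append s _), ?_⟩,
      append_cons_ne s j _⟩
    rw [backbone_succ h, cons_suffix_append_cons_iff]
    exact hj.symm

lemma forestWeight_eq (hw : ∀ v, 0 ≤ w v) (k : ℕ) :
    forestWeight X w k = (forest (next^[k] (toTree X w))).toReal := by
  classical
  have himage := attached_ne_backbone_eq_image h k
  rw [next_iterate_toTree h]
  set t := toTree X w
  set u := backbone X w k
  set z := threshold (subtree u t)
  set J := (Finset.range (X u)).erase (bestChild (subtree u t))
  have hfin : ∀ v : {v | v ∈ attached X w k ∧ v ≠ u}, (t v).2 ≠ ∞ := fun _ => ENNReal.ofReal_ne_top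
  calc forestWeight X w k
      = (∑' v : {v | v ∈ attached X w k ∧ v ≠ u}, (t v).2).toReal := by
        rw [ENNReal.tsum_toReal_eq hfin]
        exact tsum_congr fun v => (ENNReal.toReal_ofReal (hw v)).symm
    _ = (∑' j, ∑' s, if j ∈ J ∧ PathBelow z (subtree (j :: u) t) s then
          (t (s ++ j :: u)).2 else 0).toReal := by
        rw [himage, tsum_image (fun v => (t v).2)
          (append_cons_injective u).injOn, tsum_subtype _ fun p : ℕ × List ℕ =>
          (t (p.2 ++ p.1 :: u)).2, ENNReal.tsum_prod']
        simp only [Set.indicator_apply, Set.mem_ofPred_eq]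
    _ = (forest (subtree u t)).toReal := by
        rw [tsum_eq_sum (s := J) fun j hj => by simp only [hj, false_and, if_false, tsum_zero]]
        refine congrArg ENNReal.toReal (Finset.sum_congr rfl fun j hj => ?_)
        simp only [hj, true_and, clusterWeight, subtree_subtree, List.singleton_append]
        rfl

lemma B_zero : B X w 0 = forestWeight X w 0 := by
  have hset : {v | v ∈ cut X w 0 ∧ v ≠ []} = {v | v ∈ attached X w 0 ∧ v ≠ backbone X w 0} := by
    rw [(isBackbone_backbone h).1, attached]
  exact tsum_congr_set_coe w hset

lemma cutWeight_succ (k : ℕ) :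
    cutWeight X w (k + 1) = cutWeight X w k + ∑' v : attached X w (k + 1), w v := by
  have hsplit : {v | v ∈ cut X w (k + 1) ∧ v ≠ []} =
      {v | v ∈ cut X w k ∧ v ≠ []} ∪ attached X w (k + 1) := by
    have hsub : cut X w k ⊆ cut X w (k + 1) := fun v hv =>
      ⟨hv.1, fun hsuf => hv.2 (((backbone_suffix_iff h).2 (Nat.le_succ _)).trans hsuf)⟩
    have hnil : [] ∈ cut X w k := ⟨mem_cluster.2 ⟨0, nil_mem_invasion 0⟩, fun hsuf =>
      List.cons_ne_nil _ _ ((backbone_succ h k).symm.trans (List.suffix_nil.1 hsuf))⟩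
    ext v
    simp only [attached, Set.mem_union, Set.mem_ofPred_eq, Set.mem_sdiff]
    by_cases hv : v ∈ cut X w k
    · simp only [hv, hsub hv, true_and, not_true_eq_false, and_false, or_false]
    · have hne : v ≠ [] := fun hv' => hv (hv' ▸ hnil)
      simp only [hv, hne, not_false_eq_true, ne_eq, and_true, false_or]
  have hdisj : Disjoint {v | v ∈ cut X w k ∧ v ≠ []} (attached X w (k + 1)) :=
    Set.disjoint_left.2 fun v hv hv' => hv'.2 hv.1
  calc cutWeight X w (k + 1) = ∑' v : {v | v ∈ cut X w (k + 1) ∧ v ≠ []}, w v := rfl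
    _ = _ := by
      rw [hsplit, Summable.tsum_union_disjoint hdisj
        (summable_of_finite ((finite_cut h k).subset fun _ hv => hv.1))
        (summable_of_finite ((finite_cut h (k + 1)).subset fun _ hv => hv.1))]
      rfl

lemma tsum_attached_succ (k : ℕ) : ∑' v : attached X w (k + 1), w v =
    w (backbone X w (k + 1)) + forestWeight X w (k + 1) := by
  set b := backbone X w (k + 1)
  have hb : b ∈ attached X w (k + 1) := (mem_attached_iff h).2 ⟨(isBackbone_backbone h).2.2 _,
    List.suffix_refl _, (backbone_suffix_iff h).not.2 (Nat.not_succ_le_self _)⟩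
  have hfin : (attached X w (k + 1)).Finite := (finite_cut h (k + 1)).subset fun _ hv => hv.1
  have hdisj : Disjoint {b} {v | v ∈ attached X w (k + 1) ∧ v ≠ b} :=
    Set.disjoint_singleton_left.2 fun hv => hv.2 rfl
  have hsplit : attached X w (k + 1) = {b} ∪ {v | v ∈ attached X w (k + 1) ∧ v ≠ b} :=
    (Set.insert_sdiff_self_of_mem hb).symm
  calc ∑' v : attached X w (k + 1), w v
      = ∑' v : ↥({b} ∪ {v | v ∈ attached X w (k + 1) ∧ v ≠ b}), w v := tsum_congr_set_coe w hsplit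
    _ = _ := by
      rw [Summable.tsum_union_disjoint hdisj (summable_of_finite (Set.finite_singleton b))
        (summable_of_finite (hfin.subset fun _ hv => hv.1)), tsum_singleton]
      rfl

lemma B_succ (k : ℕ) :
    B X w (k + 1) = w (backbone X w (k + 1)) + forestWeight X w (k + 1) := by
  rw [B, cutWeight_succ h, tsum_attached_succ h, add_sub_cancel_left]

lemma forestWeight_eq_markSeq (hw : ∀ v, 0 ≤ w v) : forestWeight X w =
    markSeq ENNReal.toReal (fun p => p.2.toReal) (toTree X w) := by
  funext k
  rw [forestWeight_eq h hw]
  cases k <;> rfl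

lemma B_eq_markSeq (hw : ∀ v, 0 ≤ w v) : B X w =
    markSeq ENNReal.toReal (fun p => p.1.toReal + p.2.toReal) (toTree X w) := by
  funext k
  cases k with
  | zero => exact (B_zero h).trans (forestWeight_eq h hw 0)
  | succ k =>
    rw [B_succ h, forestWeight_eq h hw, ← ENNReal.toReal_ofReal (hw _)]
    simp only [markSeq, mark, next_iterate_toTree h]
    rfl

end Hanging

section Conclusion

variable {Ω : Type*} [MeasurableSpace Ω] {P : Measure Ω}

lemma CondIndepGiven.comp_of_measurePreserving {Ω' : Type*} [MeasurableSpace Ω']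
    [IsFiniteMeasure P] {Q : Measure Ω'} [IsFiniteMeasure Q] {T : Ω → Ω'}
    (hT : MeasurePreserving T P Q) {Y Z : Ω' → ℕ → ℝ} (h : CondIndepGiven Q Y Z)
    {Y' Z' : Ω → ℕ → ℝ} (hY : Y' =ᵐ[P] Y ∘ T) (hZ : Z' =ᵐ[P] Z ∘ T) : CondIndepGiven P Y' Z' := by
  obtain ⟨hT, rfl⟩ := hT
  obtain ⟨hYm, hZm, hindep⟩ := h
  refine ⟨(hYm.comp_measurable hT).congr hY.symm, (hZm.comp_measurable hT).congr hZ.symm, ?_⟩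
  have hmap : P.map Z' = (P.map T).map Z := by
    rw [Measure.map_congr hZ, AEMeasurable.map_map_of_aemeasurable hZm hT.aemeasurable]
  have hcond : condDistrib Y' Z' P = condDistrib Y Z (P.map T) := by
    rw [condDistrib_congr hY hZ, condDistrib, condDistrib]
    congr 1
    rw [AEMeasurable.map_map_of_aemeasurable (hZm.prodMk hYm) hT.aemeasurable]
    rfl
  rwa [hmap, hcond]

variable {ν : Measure ℕ} {X : List ℕ → Ω → ℕ} {w : List ℕ → Ω → ℝ}

lemma IsWeightedBPTree.ae_weight_nonneg (hT : IsWeightedBPTree P ν X w) :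
    ∀ᵐ ω ∂P, ∀ v, 0 ≤ w v ω := by
  refine ae_all_iff.2 fun v => ae_of_ae_map (hT.measurable_weight v).aemeasurable ?_
  rw [hT.law_weight v]
  filter_upwards [ae_restrict_mem measurableSet_Icc] with x hx using hx.1

lemma IsWeightedBPTree.measurePreserving_toTree [IsProbabilityMeasure P] [IsProbabilityMeasure ν]
    (hT : IsWeightedBPTree P ν X w) :
    MeasurePreserving (fun ω => toTree (fun v => X v ω) fun v => w v ω) P (bpLaw ν) := by
  have hw : ∀ v, Measurable fun ω => ENNReal.ofReal (w v ω) := fun v =>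
    (hT.measurable_weight v).ennreal_ofReal
  have hlawX : P.map (fun ω v => X v ω) = Measure.infinitePi fun _ => ν := by
    rw [(iIndepFun_iff_map_fun_eq_infinitePi_map hT.measurable_offspring).1 hT.indep_offspring]
    simp only [hT.law_offspring]
  have hlaww : P.map (fun ω v => ENNReal.ofReal (w v ω)) = Measure.infinitePi fun _ => unifLaw := by
    rw [(iIndepFun_iff_map_fun_eq_infinitePi_map hw).1
      (hT.indep_weight.comp (fun _ => ENNReal.ofReal) fun _ => ENNReal.measurable_ofReal)]
    refine congrArg Measure.infinitePi (funext fun v => ?_)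
    rw [unifLaw, ← hT.law_weight v,
      Measure.map_map ENNReal.measurable_ofReal (hT.measurable_weight v)]
    rfl
  have hindep : IndepFun (fun ω v => X v ω) (fun ω v => ENNReal.ofReal (w v ω)) P :=
    hT.indep.comp (φ := id) (ψ := fun (y : List ℕ → ℝ) v => ENNReal.ofReal (y v)) measurable_id
      (by fun_prop)
  have hmX : Measurable fun ω v => X v ω := measurable_pi_iff.2 hT.measurable_offspring
  have hmw : Measurable fun ω v => ENNReal.ofReal (w v ω) := measurable_pi_iff.2 hw
  refine ⟨measurable_pi_iff.2 fun v => (hT.measurable_offspring v).prodMk (hw v), ?_⟩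
  have hpair := (indepFun_iff_map_prod_eq_prod_map_map hmX.aemeasurable hmw.aemeasurable).1 hindep
  rw [hlawX, hlaww] at hpair
  rw [bpLaw, treeLaw, ← infinitePi_prod_infinitePi_map_prodMk, ← hpair,
    Measure.map_map (by fun_prop) (hmX.prodMk hmw)]
  rfl

lemma measure_two_le_ne_zero {α c : ℝ} (hc : c ≠ 0)
    (hν : (fun x : ℝ => ν.real {n : ℕ | x < (n : ℝ)}) ~[atTop] fun x : ℝ => c * x ^ (-α)) :
    ν {x | 2 ≤ x} ≠ 0 := by
  have hne : ∀ᶠ x : ℝ in atTop, c * x ^ (-α) ≠ 0 := by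
    filter_upwards [eventually_gt_atTop 0] with x hx
    exact mul_ne_zero hc (Real.rpow_pos_of_pos hx _).ne'
  obtain ⟨φ, hφ, heq⟩ := hν.exists_eq_mul
  obtain ⟨x, hx, hφx, hxeq, hx₁⟩ := (hne.and ((hφ.eventually_ne one_ne_zero).and
    (heq.and (eventually_ge_atTop (1 : ℝ))))).exists
  intro h₀
  have hsub : {n : ℕ | x < (n : ℝ)} ⊆ {n | 2 ≤ n} := fun n hn =>
    Nat.succ_le_of_lt (Nat.one_lt_cast.1 (hx₁.trans_lt hn))
  refine hxeq.trans_ne (mul_ne_zero hφx hx) ?_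
  exact (congrArg ENNReal.toReal (measure_mono_null hsub h₀)).trans ENNReal.toReal_zero

end Conclusion

end IPC

theorem corollary1p3_general {Ω : Type*} [MeasurableSpace Ω] (P : Measure Ω)
    [IsProbabilityMeasure P] (ν : Measure ℕ) [IsProbabilityMeasure ν] (hν₀ : ν {0} = 0)
    (hν₂ : ν {x | 2 ≤ x} ≠ 0) (X : List ℕ → Ω → ℕ) (w : List ℕ → Ω → ℝ)
    (hT : IPC.IsWeightedBPTree P ν X w) :
    (∀ᵐ ω ∂P, (∃! b : ℕ → List ℕ, IPC.IsBackbone (fun v => X v ω) (fun v => w v ω) b) ∧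
      ∀ k, (IPC.cut (fun v => X v ω) (fun v => w v ω) k).Finite) ∧
    IPC.CondIndepGiven P
      (fun ω k => IPC.B (fun v => X v ω) (fun v => w v ω) k)
      (fun ω k => IPC.futureMax (fun v => X v ω) (fun v => w v ω) k) ∧
    IPC.CondIndepGiven P
      (fun ω k => IPC.forestWeight (fun v => X v ω) (fun v => w v ω) k)
      (fun ω k => IPC.futureMax (fun v => X v ω) (fun v => w v ω) k) := by
  have hpres := hT.measurePreserving_toTree
  have hgen := hpres.quasiMeasurePreserving.ae (IPC.ae_generic hν₀ hν₂)
  have hfutureMax := (hgen.and hT.ae_weight_nonneg).mono fun _ hω =>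
    IPC.futureMax_eq_thresholds hω.1 hω.2
  refine ⟨hgen.mono fun ω h => ⟨IPC.existsUnique_isBackbone h, IPC.finite_cut h⟩,
    .comp_of_measurePreserving hpres (IPC.condIndepGiven_markSeq_thresholds hν₀ hν₂ ?_ ?_)
      ((hgen.and hT.ae_weight_nonneg).mono fun _ hω => IPC.B_eq_markSeq hω.1 hω.2) hfutureMax,
    .comp_of_measurePreserving hpres (IPC.condIndepGiven_markSeq_thresholds hν₀ hν₂ ?_ ?_)
      ((hgen.and hT.ae_weight_nonneg).mono fun _ hω => IPC.forestWeight_eq_markSeq hω.1 hω.2)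
      hfutureMax⟩
  all_goals fun_prop

theorem corollary1p3 {Ω : Type*} [MeasurableSpace Ω] (P : Measure Ω) [IsProbabilityMeasure P]
    (ν : Measure ℕ) [IsProbabilityMeasure ν] (hν₀ : ν {0} = 0)
    (α c : ℝ) (hα : 0 < α) (hc : 0 < c)
    (hν : (fun x : ℝ => ν.real {n : ℕ | x < (n : ℝ)}) ~[atTop] fun x : ℝ => c * x ^ (-α))
    (X : List ℕ → Ω → ℕ) (w : List ℕ → Ω → ℝ) (hT : IPC.IsWeightedBPTree P ν X w) :
    (∀ᵐ ω ∂P, (∃! b : ℕ → List ℕ, IPC.IsBackbone (fun v => X v ω) (fun v => w v ω) b) ∧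
      ∀ k, (IPC.cut (fun v => X v ω) (fun v => w v ω) k).Finite) ∧
    IPC.CondIndepGiven P
      (fun ω k => IPC.B (fun v => X v ω) (fun v => w v ω) k)
      (fun ω k => IPC.futureMax (fun v => X v ω) (fun v => w v ω) k) ∧
    IPC.CondIndepGiven P
      (fun ω k => IPC.forestWeight (fun v => X v ω) (fun v => w v ω) k)
      (fun ω k => IPC.futureMax (fun v => X v ω) (fun v => w v ω) k) :=
  corollary1p3_general P ν hν₀ (IPC.measure_two_le_ne_zero hc.ne' hν) X w hT
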